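/- Let $q\ge 1$ and $b_1,\dots,b_q\in\mathbb{C}$. Assume that $b_1,\dots,b_q$ are numbered so that their congruence classes mod $\mathbb{Z}$ (as a multiset) are consecutive blocks, of sizes $n_1,\dots,n_r\ge 1$ with $n_1+\dots+n_r=q$, and that within each block the real parts are non-increasing. For $1\le j\le q$, let $i+1,\dots,i+k$ be the indices of the block that contains $j$ and write $j=i+\ell$, $1\le \ell\le k$; put $S_j=\{i+1,\dots,i+\ell\}$. Define Meijer's function on the Riemann surface of the logarithm by $$G_j(z)=G^{\ell,0}_{0,q}\bigl(b_{i+1},\dots,b_{i+\ell};\,\text{the remaining } b\text{'s}\,\big|\,z\bigr)=-\sum_{\omega_0}\operatorname*{Res}_{\omega=\omega_0}\ \frac{\prod_{s\in S_j}\Gamma(b_s-\omega)}{\prod_{s\notin S_j}\Gamma(1-b_s+\omega)}\,z^{\omega},$$ where $\omega_0$ runs through the set $\bigcup_{s\in S_j}(b_s+\mathbb{N}_0)$ and $z^\omega=e^{\omega\log z}$; i.e. the Mellin--Barnes integral over a contour encircling these poles once in negative orientation. Poles of higher order are allowed. Then the following hold. (i) For all $j$ and all values of $\log z$ the sum of residues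 converges absolutely. (ii) Let $U\subseteq\mathbb{C}\setminus\{0\}$ be open and connected (and non-empty), and suppose that for each $j$ a continuous branch of $\log((-1)^{\ell}\zeta)$ on $U$ is chosen, with $\ell=\ell(j)$ the position of $j$ in its block. Then the functions $$y_j(\zeta)=G_j\bigl((-1)^{\ell}\zeta\bigr),\qquad 1\le j\le q,$$ form a fundamental system of solutions on $U$ of the $q$th-order equation $$\Bigl[\prod_{j=1}^q\Bigl(\zeta\frac{d}{d\zeta}-b_j\Bigr)-\zeta\Bigr]u(\zeta)=0,$$ that is, they are holomorphic solutions on $U$, they are linearly independent over $\mathbb{C}$, and every holomorphic solution on $U$ is a linear combination of them. (iii) If $j$ is the first index of its block ($\ell=1$), then for $\zeta\in U$, with the same branch, $$y_j(\zeta)=\frac{(-\zeta)^{b_j}}{\prod_{j'=1}^q\Gamma(1+b_j-b_{j'})}\;{}_0F_{q-1}\bigl(;\,(1+b_j-b_{j'})_{j'\ne j}\,\big|\,\zeta\bigr),$$ where ${}_0F_{q-1}(;\beta_1,\dots,\beta_{q-1}\,|\,\zeta)=\sum_{k\ge0}\zeta^k/\bigl(k!\,\prod_{m}(\beta_m)_k\bigr)$.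 (iv) Let $d_j=\#\{s\in S_j: b_s=b_j\}$. There is a constant $C_j\neq0$ such that, for every $A>0$, $$\frac{G_j(z)}{z^{b_j}(\log z)^{d_j-1}}\longrightarrow C_j\quad\text{as } |z|\to0 \text{ with } |\arg z|\le A .$$ In particular, logarithms occur in the leading small-$\zeta$ behaviour of $y_j$ whenever $b_j$ is repeated among $b_{i+1},\dots,b_{i+\ell}$. -/

import Mathlib

open Filter Topology

noncomputable section

namespace MeijerEuler

/-- The residue of `f` at an isolated singularity `a`: the value `(2πi)⁻¹ ∮ f` over all
sufficiently small positively oriented circles around `a`. -/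
def residue (f : ℂ → ℂ) (a : ℂ) : ℂ :=
  limUnder (𝓝[>] (0 : ℝ))
    (fun r : ℝ => (2 * Real.pi * Complex.I)⁻¹ * ∮ w in C(a, r), f w)

/-- The Mellin--Barnes integrand of `G^{m,0}_{0,q}`. The parameters `b i` with `i ∈ S` are those to
the left of the semicolon (so `m = S.card`), the others are those to its right. The argument `z` of
the `G`-function is given by one of its logarithms `t`, so that `z ^ ω = exp (ω * t)`; this makes
the `G`-function a function on the Riemann surface of the logarithm. -/
def meijerIntegrand {q : ℕ} (b : Fin q → ℂ) (S : Finset (Fin q)) (t ω : ℂ) : ℂ :=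
  (∏ i ∈ S, Complex.Gamma (b i - ω)) / (∏ i ∈ Sᶜ, Complex.Gamma (1 - b i + ω)) *
    Complex.exp (ω * t)

/-- The poles of the functions `ω ↦ Γ(b i - ω)`, `i ∈ S`. -/
def meijerPoles {q : ℕ} (b : Fin q → ℂ) (S : Finset (Fin q)) : Set ℂ :=
  {ω | ∃ i ∈ S, ∃ n : ℕ, ω = b i + n}

/-- Meijer's function `G^{m,0}_{0,q}(b i, i ∈ S; b i, i ∉ S | z)` at `z = exp t`: the Mellin--Barnes
integral over a contour that encircles the poles once in negative orientation, that is, minus the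
sum of the residues of the integrand. -/
def meijerG {q : ℕ} (b : Fin q → ℂ) (S : Finset (Fin q)) (t : ℂ) : ℂ :=
  -∑' ω : meijerPoles b S, residue (meijerIntegrand b S t) ω

/-- The generalized hypergeometric function `₀F_s` with lower parameters `β`. -/
def hypergeometricZeroF {κ : Type*} [Fintype κ] (β : κ → ℂ) (ζ : ℂ) : ℂ :=
  ∑' k : ℕ, ζ ^ k / ((∏ i, (ascPochhammer ℂ k).eval (β i)) * (k.factorial : ℂ))

/-- The first-order operator `ζ d/dζ - c`. -/
def eulerFactor (c : ℂ) (u : ℂ → ℂ) : ℂ → ℂ :=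
  fun ζ => ζ * deriv u ζ - c * u ζ

/-- The operator `∏ j, (ζ d/dζ - b j)`. -/
def eulerProd {q : ℕ} (b : Fin q → ℂ) (u : ℂ → ℂ) : ℂ → ℂ :=
  (List.ofFn b).foldr eulerFactor u

/-- `u` is a (holomorphic) solution of `[∏ j, (ζ d/dζ - b j) - ζ] u = 0` on the open set `U`. -/
def IsSolution {q : ℕ} (b : Fin q → ℂ) (U : Set ℂ) (u : ℂ → ℂ) : Prop :=
  DifferentiableOn ℂ u U ∧ ∀ ζ ∈ U, eulerProd b u ζ - ζ * u ζ = 0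

/-- `y 0, …, y (q - 1)` is a fundamental system on `U`, that is, a basis of the solution space. -/
def IsFundamentalSystem {q : ℕ} (b : Fin q → ℂ) (U : Set ℂ) (y : Fin q → ℂ → ℂ) : Prop :=
  (∀ j, IsSolution b U (y j)) ∧
  LinearIndependent ℂ (fun j => fun ζ : U => y j ζ) ∧
  ∀ u, IsSolution b U u → ∃ a : Fin q → ℂ, ∀ ζ ∈ U, u ζ = ∑ j, a j * y j ζ

/-- The position `ℓ = 1, …, n_s` of the index `j` within its block of the composition
`q = n_1 + ⋯ + n_r`. -/
def pos {q : ℕ} (c : Composition q) (j : Fin q) : ℕ :=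
  (c.invEmbedding j : ℕ) + 1

/-- The indices of the block of `j` up to and including `j`. -/
def upTo {q : ℕ} (c : Composition q) (j : Fin q) : Finset (Fin q) :=
  Finset.univ.filter (fun i => c.index i = c.index j ∧ i ≤ j)

/-- The number of the parameters `b i`, `i` in the block of `j` and `i ≤ j`, that are equal
to `b j`. -/
def mult {q : ℕ} (c : Composition q) (b : Fin q → ℂ) (j : Fin q) : ℕ :=
  Nat.card {i // i ∈ upTo c j ∧ b i = b j}

end MeijerEuler

end

/-!
Write `t = log z`. The poles of the `j`-th integrand form the single progression `b_j + ℕ`, and the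
recurrence of the Gamma function makes the residues decay super-exponentially. Under the integral
`ζ d/dζ` is multiplication by `ω`, and by the same recurrence `∏ (ω - b_i)` shifts the contour by
one unit, across no pole: this is the differential equation.

The residue at `b_j`, a pole of order `d_j`, gives the leading term `z ^ b_j (log z) ^ (d_j - 1)` at
the origin. The pairs `(b_j, d_j)` are distinct. A linear relation on `U` continues analytically to
the whole surface of the logarithm, and along `t → -∞` its dominant terms would make a combination
of oscillating exponentials with distinct frequencies tend to zero. Finally, a solution is fixed by
its derivatives of order `< q` at a point, so `q` independent ones form a basis.
-/

noncomputable section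

namespace MeijerEuler

open Bornology Complex Metric Set

lemma hasDerivAt_circleIntegral_mul_cexp {M : ℂ → ℂ} {a : ℂ} {r : ℝ} (hr : 0 ≤ r)
    (hM : ContinuousOn M (sphere a r)) (t : ℂ) :
    HasDerivAt (fun t => ∮ ω in C(a, r), M ω * cexp (ω * t))
      (∮ ω in C(a, r), ω * M ω * cexp (ω * t)) t := by
  have hcirc := continuous_circleMap a r
  have hMc : Continuous fun θ : ℝ => M (circleMap a r θ) :=
    hM.comp_continuous hcirc (circleMap_mem_sphere a hr)
  have hF (x : ℂ) : Continuous fun θ : ℝ => deriv (circleMap a r) θ •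
      (M (circleMap a r θ) * cexp (circleMap a r θ * x)) := by
    simp only [deriv_circleMap, smul_eq_mul]
    exact (((continuous_circleMap 0 r).mul continuous_const).mul
      (hMc.mul (hcirc.mul continuous_const).cexp))
  have hF' : Continuous fun p : ℂ × ℝ => deriv (circleMap a r) p.2 •
      (circleMap a r p.2 * M (circleMap a r p.2) * cexp (circleMap a r p.2 * p.1)) := by
    have hcirc₂ : Continuous fun p : ℂ × ℝ => circleMap a r p.2 := hcirc.comp continuous_snd
    simp only [deriv_circleMap, smul_eq_mul]
    exact ((((continuous_circleMap 0 r).comp continuous_snd).mul continuous_const).mul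
      ((hcirc₂.mul (hMc.comp continuous_snd)).mul (hcirc₂.mul continuous_fst).cexp))
  obtain ⟨K, hK⟩ := ((isCompact_closedBall t 1).prod
    (isCompact_uIcc (a := (0 : ℝ)) (b := 2 * Real.pi))).exists_bound_of_continuousOn
      hF'.continuousOn
  refine (intervalIntegral.hasDerivAt_integral_of_dominated_loc_of_deriv_le
    (s := closedBall t 1) (bound := fun _ => K)
    (F' := fun x θ => deriv (circleMap a r) θ •
      (circleMap a r θ * M (circleMap a r θ) * cexp (circleMap a r θ * x)))
    (closedBall_mem_nhds t one_pos) ?_ ?_ ?_ ?_ ?_ ?_).2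
  · exact Eventually.of_forall fun x => (hF x).aestronglyMeasurable
  · exact (hF t).intervalIntegrable _ _
  · exact (hF'.comp (by fun_prop : Continuous fun θ : ℝ => (t, θ))).aestronglyMeasurable
  · exact Eventually.of_forall fun θ hθ x hx => hK (x, θ) ⟨hx, uIoc_subset_uIcc hθ⟩
  · exact intervalIntegrable_const
  · refine Eventually.of_forall fun θ _ x _ => HasDerivAt.fun_const_smul _ ?_
    refine (((hasDerivAt_id x).const_mul (circleMap a r θ)).cexp.const_mul
      (M (circleMap a r θ))).congr_deriv ?_
    simp only [id, mul_one]
    ring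

/-- The residue term `(2πi)⁻¹ ∮ M(ω) z ^ ω dω` at `z = exp t`, over the circle of radius `1/2`
around `a`. -/
def contourTerm (M : ℂ → ℂ) (a t : ℂ) : ℂ :=
  (2 * Real.pi * I)⁻¹ * ∮ ω in C(a, 1 / 2), M ω * cexp (ω * t)

/-- The Mellin--Barnes series of the kernel `M` at `z = exp t`: the sum of the residue terms over
the poles `β, β + 1, …`. -/
def mellinBarnes (M : ℂ → ℂ) (β t : ℂ) : ℂ :=
  ∑' m : ℕ, contourTerm M (β + m) t

/-- The kernel `M` decays faster than every geometric sequence along the circles of radius `1/2`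
around `β, β + 1, …`; this makes its Mellin--Barnes series an entire function of `t`. -/
structure RapidlyDecaying (M : ℂ → ℂ) (β : ℂ) : Prop where
  continuousOn (m : ℕ) : ContinuousOn M (sphere (β + m) (1 / 2))
  bounded (R : ℝ) (hR : 0 < R) :
    ∃ K, ∀ m : ℕ, ∀ ω ∈ sphere (β + m) (1 / 2), ‖M ω‖ * R ^ m ≤ K

section contourTerm

variable {M N : ℂ → ℂ} {a : ℂ}

lemma contourTerm_congr (h : EqOn M N (sphere a (1 / 2))) (t : ℂ) :
    contourTerm M a t = contourTerm N a t := by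
  rw [contourTerm, contourTerm,
    circleIntegral.integral_congr (by norm_num) fun ω hω => by rw [h hω]]

lemma contourTerm_const_mul (c : ℂ) (M : ℂ → ℂ) (a t : ℂ) :
    contourTerm (fun ω => c * M ω) a t = c * contourTerm M a t := by
  simp only [contourTerm, mul_assoc c, circleIntegral.integral_const_mul]
  ring

lemma contourTerm_add_one (M : ℂ → ℂ) (a t : ℂ) :
    contourTerm M (a + 1) t = cexp t * contourTerm (fun ω => M (ω + 1)) a t := by
  have hshift : ∮ ω in C(a + 1, 1 / 2), M ω * cexp (ω * t) =
      cexp t * ∮ ω in C(a, 1 / 2), M (ω + 1) * cexp (ω * t) := by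
    rw [← circleIntegral.integral_const_mul]
    simp only [circleIntegral, deriv_circleMap, circleMap]
    refine intervalIntegral.integral_congr fun θ _ => ?_
    simp only [smul_eq_mul, add_right_comm a 1, add_mul _ 1 t, one_mul, Complex.exp_add]
    ring
  rw [contourTerm, contourTerm, hshift]
  ring

lemma contourTerm_eq_zero (hM : DifferentiableOn ℂ M (closedBall a (1 / 2))) (t : ℂ) :
    contourTerm M a t = 0 := by
  have hd : DifferentiableOn ℂ (fun ω => M ω * cexp (ω * t)) (closedBall a (1 / 2)) :=
    hM.mul (by fun_prop)
  rw [contourTerm, (hd.diffContOnCl_ball subset_rfl).circleIntegral_eq_zero (by norm_num), mul_zero]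

lemma norm_cexp_mul_le_of_mem_sphere {ω : ℂ} (hω : ω ∈ sphere a (1 / 2)) (t : ℂ) :
    ‖cexp (ω * t)‖ ≤ ‖cexp (a * t)‖ * Real.exp (‖t‖ / 2) := by
  have hω' : ‖ω - a‖ = 1 / 2 := mem_sphere_iff_norm.1 hω
  calc ‖cexp (ω * t)‖ = ‖cexp (a * t)‖ * ‖cexp ((ω - a) * t)‖ := by
        rw [← norm_mul, ← Complex.exp_add]; ring_nf
    _ ≤ ‖cexp (a * t)‖ * Real.exp ‖(ω - a) * t‖ := by gcongr; exact norm_exp_le_exp_norm _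
    _ = ‖cexp (a * t)‖ * Real.exp (‖t‖ / 2) := by rw [norm_mul, hω']; ring_nf

lemma norm_contourTerm_le {K : ℝ} (hM : ∀ ω ∈ sphere a (1 / 2), ‖M ω‖ ≤ K) (t : ℂ) :
    ‖contourTerm M a t‖ ≤ K * (‖cexp (a * t)‖ * Real.exp (‖t‖ / 2)) := by
  obtain ⟨ω₀, hω₀⟩ : (sphere a (1 / 2)).Nonempty := NormedSpace.sphere_nonempty.2 (by norm_num)
  have hK : 0 ≤ K := (norm_nonneg _).trans (hM ω₀ hω₀)
  refine (circleIntegral.norm_two_pi_i_inv_smul_integral_le_of_norm_le_const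
    (C := K * (‖cexp (a * t)‖ * Real.exp (‖t‖ / 2))) (by norm_num) fun ω hω => ?_).trans
    (mul_le_of_le_one_left (by positivity) (by norm_num))
  rw [norm_mul]
  exact mul_le_mul (hM ω hω) (norm_cexp_mul_le_of_mem_sphere hω t) (norm_nonneg _) hK

lemma hasDerivAt_contourTerm (hM : ContinuousOn M (sphere a (1 / 2))) (t : ℂ) :
    HasDerivAt (contourTerm M a) (contourTerm (fun ω => ω * M ω) a t) t :=
  (hasDerivAt_circleIntegral_mul_cexp (by norm_num) hM t).const_mul _

lemma contourTerm_sub_const_mul (hM : ContinuousOn M (sphere a (1 / 2))) (c t : ℂ) :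
    contourTerm (fun ω => (ω - c) * M ω) a t =
      contourTerm (fun ω => ω * M ω) a t - c * contourTerm M a t := by
  have hint {N : ℂ → ℂ} (hN : ContinuousOn N (sphere a (1 / 2))) :
      CircleIntegrable (fun ω => N ω * cexp (ω * t)) a (1 / 2) :=
    ContinuousOn.circleIntegrable (by norm_num) (hN.mul (by fun_prop))
  rw [← contourTerm_const_mul c, contourTerm, contourTerm, contourTerm, ← mul_sub,
    ← circleIntegral.integral_sub (hint (N := fun ω => ω * M ω) (continuousOn_id.mul hM))
      (hint (N := fun ω => c * M ω) (continuousOn_const.mul hM))]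
  simp only [sub_mul]

end contourTerm

namespace RapidlyDecaying

variable {M : ℂ → ℂ} {β : ℂ}

lemma mul_of_norm_le {h : ℂ → ℂ} {H ρ : ℝ} (hM : RapidlyDecaying M β) (hh : Continuous h)
    (hρ : 0 < ρ) (hle : ∀ m : ℕ, ∀ ω ∈ sphere (β + m) (1 / 2), ‖h ω‖ ≤ H * ρ ^ m) :
    RapidlyDecaying (fun ω => h ω * M ω) β where
  continuousOn m := hh.continuousOn.mul (hM.continuousOn m)
  bounded R hR := by
    obtain ⟨K, hK⟩ := hM.bounded (ρ * R) (by positivity)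
    refine ⟨|H| * K, fun m ω hω => ?_⟩
    calc ‖h ω * M ω‖ * R ^ m ≤ |H| * ρ ^ m * ‖M ω‖ * R ^ m := by
          rw [norm_mul]
          gcongr
          exact (hle m ω hω).trans (by gcongr; exact le_abs_self H)
      _ = |H| * (‖M ω‖ * (ρ * R) ^ m) := by rw [mul_pow]; ring
      _ ≤ |H| * K := by gcongr; exact hK m ω hω

lemma sub_const_mul (hM : RapidlyDecaying M β) (c : ℂ) :
    RapidlyDecaying (fun ω => (ω - c) * M ω) β := by
  refine hM.mul_of_norm_le (H := ‖β - c‖ + 2) (by fun_prop) two_pos fun m ω hω => ?_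
  have hm : (m : ℝ) ≤ 2 ^ m := mod_cast m.lt_two_pow_self.le
  have hm₁ : (1 : ℝ) ≤ 2 ^ m := one_le_pow₀ one_le_two
  calc ‖ω - c‖ = ‖(β - c) + m + (ω - (β + m))‖ := by ring_nf
    _ ≤ ‖β - c‖ + m + 1 / 2 := by
        refine (norm_add₃_le).trans ?_
        rw [mem_sphere_iff_norm.1 hω, norm_natCast]
    _ ≤ (‖β - c‖ + 2) * 2 ^ m := by nlinarith [norm_nonneg (β - c)]

lemma id_mul (hM : RapidlyDecaying M β) : RapidlyDecaying (fun ω => ω * M ω) β := by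
  simpa only [sub_zero] using hM.sub_const_mul 0

lemma list_prod_mul (hM : RapidlyDecaying M β) (l : List ℂ) :
    RapidlyDecaying (fun ω => (l.map (ω - ·)).prod * M ω) β := by
  induction l with
  | nil => simpa using hM
  | cons c l ih => simpa only [List.map_cons, List.prod_cons, mul_assoc] using ih.sub_const_mul c

lemma add_one (hM : RapidlyDecaying M β) : RapidlyDecaying M (β + 1) := by
  have hcenter (m : ℕ) : β + 1 + m = β + (m + 1 : ℕ) := by push_cast; ring
  refine ⟨fun m => by rw [hcenter]; exact hM.continuousOn _, fun R hR => ?_⟩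
  obtain ⟨K, hK⟩ := hM.bounded R hR
  refine ⟨K / R, fun m ω hω => ?_⟩
  rw [hcenter] at hω
  rw [le_div_iff₀ hR, mul_assoc, ← pow_succ]
  exact hK (m + 1) ω hω

lemma exists_norm_contourTerm_le (hM : RapidlyDecaying M β) (ρ : ℝ) :
    ∃ K, ∀ (m : ℕ) (t : ℂ), t.re ≤ ρ →
      ‖contourTerm M (β + m) t‖ ≤
        K * (‖cexp (β * t)‖ * Real.exp (‖t‖ / 2)) * (1 / 2) ^ m := by
  obtain ⟨K, hK⟩ := hM.bounded (2 * Real.exp ρ) (by positivity)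
  refine ⟨K, fun m t ht => ?_⟩
  have hM' : ∀ ω ∈ sphere (β + m) (1 / 2), ‖M ω‖ ≤ K / (2 * Real.exp ρ) ^ m := fun ω hω =>
    (le_div_iff₀ (by positivity)).2 (hK m ω hω)
  have hK₀ : 0 ≤ K / (2 * Real.exp ρ) ^ m := by
    obtain ⟨ω, hω⟩ : (sphere (β + m) (1 / 2)).Nonempty :=
      NormedSpace.sphere_nonempty.2 (by norm_num)
    exact (norm_nonneg _).trans (hM' ω hω)
  have hexp : ‖cexp ((β + m) * t)‖ ≤ ‖cexp (β * t)‖ * Real.exp ρ ^ m := by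
    rw [add_mul, Complex.exp_add, Complex.exp_nat_mul, norm_mul, norm_pow, norm_exp t]
    gcongr
  calc ‖contourTerm M (β + m) t‖
      ≤ K / (2 * Real.exp ρ) ^ m * (‖cexp ((β + m) * t)‖ * Real.exp (‖t‖ / 2)) :=
        norm_contourTerm_le hM' t
    _ ≤ K / (2 * Real.exp ρ) ^ m * (‖cexp (β * t)‖ * Real.exp ρ ^ m * Real.exp (‖t‖ / 2)) := by
        gcongr
    _ = K * (‖cexp (β * t)‖ * Real.exp (‖t‖ / 2)) * (1 / 2) ^ m := by
        rw [mul_pow, div_pow]; field_simp; ring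

lemma summable_norm_contourTerm (hM : RapidlyDecaying M β) (t : ℂ) :
    Summable fun m : ℕ => ‖contourTerm M (β + m) t‖ := by
  obtain ⟨K, hK⟩ := hM.exists_norm_contourTerm_le t.re
  exact (summable_geometric_two.mul_left _).of_nonneg_of_le (fun _ => norm_nonneg _)
    fun m => hK m t le_rfl

lemma exists_norm_mellinBarnes_le (hM : RapidlyDecaying M β) :
    ∃ K, ∀ t : ℂ, t.re ≤ 0 →
      ‖mellinBarnes M β t‖ ≤ K * (‖cexp (β * t)‖ * Real.exp (‖t‖ / 2)) := by
  obtain ⟨K, hK⟩ := hM.exists_norm_contourTerm_le 0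
  refine ⟨2 * K, fun t ht => ?_⟩
  refine (tsum_of_norm_bounded (hasSum_geometric_two.mul_left _) fun m => hK m t ht).trans_eq ?_
  ring

lemma hasDerivAt_mellinBarnes (hM : RapidlyDecaying M β) (t : ℂ) :
    HasDerivAt (mellinBarnes M β) (mellinBarnes (fun ω => ω * M ω) β t) t := by
  obtain ⟨K, hK⟩ := hM.id_mul.exists_norm_contourTerm_le (‖t‖ + 1)
  have ht : t ∈ ball (0 : ℂ) (‖t‖ + 1) := by simp
  refine hasDerivAt_tsum_of_isPreconnected (t := ball 0 (‖t‖ + 1)) (y₀ := t)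
    (summable_geometric_two.mul_left
      (|K| * (Real.exp (‖β‖ * (‖t‖ + 1)) * Real.exp ((‖t‖ + 1) / 2)))) isOpen_ball
    (convex_ball 0 _).isPreconnected
    (fun m x _ => hasDerivAt_contourTerm (hM.continuousOn m) x) (fun m x hx => ?_) ht
    (hM.summable_norm_contourTerm t).of_norm ht
  have hx' : ‖x‖ ≤ ‖t‖ + 1 := (mem_ball_zero_iff.1 hx).le
  refine (hK m x ((re_le_norm x).trans hx')).trans ?_
  gcongr
  · exact le_abs_self K
  · calc ‖cexp (β * x)‖ ≤ Real.exp ‖β * x‖ := norm_exp_le_exp_norm _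
      _ ≤ Real.exp (‖β‖ * (‖t‖ + 1)) := by rw [norm_mul]; gcongr

lemma mellinBarnes_eq_add (hM : RapidlyDecaying M (β + 1)) (t : ℂ) :
    mellinBarnes M β t = contourTerm M β t + mellinBarnes M (β + 1) t := by
  have hcenter (m : ℕ) : β + (m + 1 : ℕ) = β + 1 + m := by push_cast; ring
  have hsum : Summable fun m : ℕ => contourTerm M (β + (m + 1 : ℕ)) t := by
    simpa only [hcenter] using (hM.summable_norm_contourTerm t).of_norm
  calc mellinBarnes M β t
    _ = contourTerm M (β + (0 : ℕ)) t + ∑' m : ℕ, contourTerm M (β + (m + 1 : ℕ)) t :=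
        tsum_eq_zero_add' (f := fun m : ℕ => contourTerm M (β + m) t) hsum
    _ = contourTerm M β t + mellinBarnes M (β + 1) t := by
        simp only [hcenter, Nat.cast_zero, add_zero, mellinBarnes]

end RapidlyDecaying

lemma mellinBarnes_sub_const_mul {M : ℂ → ℂ} {β : ℂ} (hM : RapidlyDecaying M β) (c t : ℂ) :
    mellinBarnes (fun ω => (ω - c) * M ω) β t =
      mellinBarnes (fun ω => ω * M ω) β t - c * mellinBarnes M β t := by
  simp only [mellinBarnes, contourTerm_sub_const_mul (hM.continuousOn _), ← tsum_mul_left]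
  exact (hM.id_mul.summable_norm_contourTerm t).of_norm.tsum_sub
    ((hM.summable_norm_contourTerm t).of_norm.mul_left c)

lemma mellinBarnes_const_mul (c : ℂ) (M : ℂ → ℂ) (β t : ℂ) :
    mellinBarnes (fun ω => c * M ω) β t = c * mellinBarnes M β t := by
  simp only [mellinBarnes, contourTerm_const_mul, tsum_mul_left]

lemma mellinBarnes_add_one (M : ℂ → ℂ) (β t : ℂ) :
    mellinBarnes M (β + 1) t = cexp t * mellinBarnes (fun ω => M (ω + 1)) β t := by
  simp only [mellinBarnes, add_right_comm β 1, contourTerm_add_one, tsum_mul_left]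

lemma mellinBarnes_congr {M N : ℂ → ℂ} {β : ℂ}
    (h : ∀ m : ℕ, EqOn M N (sphere (β + m) (1 / 2))) (t : ℂ) :
    mellinBarnes M β t = mellinBarnes N β t :=
  tsum_congr fun m => contourTerm_congr (h m) t

lemma rapidlyDecaying_of_norm_add_one_le {M : ℂ → ℂ} {β : ℂ}
    (hc : ∀ m : ℕ, ContinuousOn M (sphere (β + m) (1 / 2)))
    (hM : ∀ R : ℝ, ∀ᶠ m : ℕ in atTop, ∀ ω ∈ sphere (β + m) (1 / 2), R * ‖M (ω + 1)‖ ≤ ‖M ω‖) :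
    RapidlyDecaying M β := by
  refine ⟨hc, fun R hR => ?_⟩
  obtain ⟨n, hn⟩ := eventually_atTop.1 (hM R)
  have hK (m : ℕ) : ∃ K, ∀ ω ∈ sphere (β + m) (1 / 2), ‖M ω‖ * R ^ m ≤ K := by
    obtain ⟨K, hK⟩ := (isCompact_sphere _ _).exists_bound_of_continuousOn (hc m)
    exact ⟨K * R ^ m, fun ω hω => by gcongr; exact hK ω hω⟩
  choose K hK using hK
  have hmono (m : ℕ) (hm : n ≤ m) : ∀ ω ∈ sphere (β + m) (1 / 2), ‖M ω‖ * R ^ m ≤ K n := by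
    induction m, hm using Nat.le_induction with
    | base => exact hK n
    | succ m hm ih =>
      intro ω hω
      have hω' : ω - 1 ∈ sphere (β + m) (1 / 2) := by
        rw [mem_sphere_iff_norm] at hω ⊢
        rw [← hω]
        push_cast
        ring_nf
      have hratio := hn m hm _ hω'
      rw [sub_add_cancel] at hratio
      calc ‖M ω‖ * R ^ (m + 1) = R * ‖M ω‖ * R ^ m := by ring
        _ ≤ ‖M (ω - 1)‖ * R ^ m := by gcongr
        _ ≤ K n := ih _ hω'
  refine ⟨∑ m ∈ Finset.range (n + 1), |K m|, fun m ω hω => ?_⟩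
  have hle (k : ℕ) (hk : k ≤ n) : K k ≤ ∑ m ∈ Finset.range (n + 1), |K m| :=
    (le_abs_self _).trans (Finset.single_le_sum (f := fun m => |K m|)
      (fun _ _ => abs_nonneg _) (Finset.mem_range_succ_iff.2 hk))
  rcases le_total n m with hm | hm
  · exact (hmono m hm ω hω).trans (hle n le_rfl)
  · exact (hK m ω hω).trans (hle m hm)

lemma residue_eq {f : ℂ → ℂ} {a : ℂ} {r R : ℝ} (hf : DifferentiableOn ℂ f (ball a R \ {a}))
    (hr : 0 < r) (hrR : r < R) :
    residue f a = (2 * Real.pi * I)⁻¹ * ∮ ω in C(a, r), f ω := by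
  have hmem {ρ : ℝ} (hρ : 0 < ρ) {ω : ℂ} (hω : ω ∈ closedBall a r \ ball a ρ) :
      ω ∈ ball a R \ {a} := by
    refine ⟨closedBall_subset_ball hrR hω.1, ?_⟩
    rintro rfl
    exact hω.2 (mem_ball_self hρ)
  have hopen : IsOpen (ball a R \ {a}) := isOpen_ball.sdiff isClosed_singleton
  have hcircle {ρ : ℝ} (hρ : 0 < ρ) (hρr : ρ ≤ r) :
      ∮ ω in C(a, r), f ω = ∮ ω in C(a, ρ), f ω :=
    circleIntegral_eq_of_differentiable_on_annulus_off_countable hρ hρr countable_empty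
      (hf.continuousOn.mono fun _ hω => hmem hρ hω)
      fun ω hω => hf.differentiableAt <| hopen.mem_nhds <| hmem hρ
        ⟨ball_subset_closedBall hω.1.1, fun h => hω.1.2 (ball_subset_closedBall h)⟩
  refine Tendsto.limUnder_eq (tendsto_const_nhds.congr' ?_)
  filter_upwards [Ioo_mem_nhdsGT hr] with ρ hρ
  rw [hcircle hρ.1 hρ.2.le]

section meijerKernel

variable {q : ℕ} {b : Fin q → ℂ} {S : Finset (Fin q)} {β : ℂ}

/-- The factor of the Mellin--Barnes integrand of `G^{m,0}_{0,q}` that does not depend on the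
argument, with the same conventions as in `meijerIntegrand`. -/
def meijerKernel (b : Fin q → ℂ) (S : Finset (Fin q)) (ω : ℂ) : ℂ :=
  (∏ i ∈ S, Gamma (b i - ω)) * ∏ i ∈ Sᶜ, (Gamma (1 - b i + ω))⁻¹

lemma meijerIntegrand_eq (b : Fin q → ℂ) (S : Finset (Fin q)) (t ω : ℂ) :
    meijerIntegrand b S t ω = meijerKernel b S ω * cexp (ω * t) := by
  rw [meijerIntegrand, meijerKernel, Finset.prod_inv_distrib, div_eq_mul_inv]

lemma differentiable_prod_inv_Gamma (b : Fin q → ℂ) (S : Finset (Fin q)) :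
    Differentiable ℂ fun ω => ∏ i ∈ S, (Gamma (1 - b i + ω))⁻¹ :=
  Differentiable.fun_finsetProd fun i _ => differentiable_one_div_Gamma.comp (by fun_prop)

lemma differentiableAt_meijerKernel {ω : ℂ} (hω : ω ∉ meijerPoles b S) :
    DifferentiableAt ℂ (meijerKernel b S) ω := by
  refine DifferentiableAt.mul (DifferentiableAt.fun_finsetProd fun i hi => ?_)
    (differentiable_prod_inv_Gamma b Sᶜ ω)
  have hGamma : DifferentiableAt ℂ Gamma (b i - ω) :=
    differentiableAt_Gamma _ fun n hn => hω ⟨i, hi, n, by linear_combination -hn⟩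
  exact hGamma.comp ω (by fun_prop)

/-- With `ζ d/dζ` acting as multiplication by `ω`, this recurrence is the differential equation. -/
lemma prod_mul_meijerKernel_add_one {ω : ℂ} (hω : ω + 1 ∉ meijerPoles b S) :
    (∏ i, (ω + 1 - b i)) * meijerKernel b S (ω + 1) = (-1) ^ S.card * meijerKernel b S ω := by
  have hS : ∀ i ∈ S, (ω + 1 - b i) * Gamma (b i - (ω + 1)) = -1 * Gamma (b i - ω) := by
    intro i hi
    have hne : b i - (ω + 1) ≠ 0 := fun h => hω ⟨i, hi, 0, by push_cast; linear_combination -h⟩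
    rw [show b i - ω = b i - (ω + 1) + 1 by ring, Gamma_add_one _ hne]
    ring
  have hSc : ∀ i ∈ Sᶜ, (ω + 1 - b i) * (Gamma (1 - b i + (ω + 1)))⁻¹ = (Gamma (1 - b i + ω))⁻¹ := by
    intro i _
    rw [one_div_Gamma_eq_self_mul_one_div_Gamma_add_one (1 - b i + ω), ← add_assoc _ ω 1]
    ring
  calc (∏ i, (ω + 1 - b i)) * meijerKernel b S (ω + 1)
      = (∏ i ∈ S, (ω + 1 - b i) * Gamma (b i - (ω + 1))) *
          ∏ i ∈ Sᶜ, (ω + 1 - b i) * (Gamma (1 - b i + (ω + 1)))⁻¹ := by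
        rw [← Finset.prod_mul_prod_compl S, meijerKernel, mul_mul_mul_comm,
          ← Finset.prod_mul_distrib, ← Finset.prod_mul_distrib]
    _ = (-1) ^ S.card * meijerKernel b S ω := by
        rw [Finset.prod_congr rfl hS, Finset.prod_congr rfl hSc, Finset.prod_mul_distrib,
          Finset.prod_const, meijerKernel, mul_assoc]

lemma natCast_eq_of_norm_sub_lt_one {m : ℕ} {k : ℤ} (h : ‖β + m - (β + k)‖ < 1) : (m : ℤ) = k := by
  rw [show β + m - (β + k) = ((m - k : ℤ) : ℂ) by push_cast; ring, norm_intCast] at h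
  exact sub_eq_zero.1 (Int.abs_lt_one_iff.1 (mod_cast h))

lemma notMem_meijerPoles_of_mem_punctured_ball
    (hpoles : meijerPoles b S = range fun m : ℕ => β + m) {m : ℕ} {ω : ℂ}
    (hω : ω ∈ ball (β + m) 1 \ {β + (m : ℂ)}) : ω ∉ meijerPoles b S := by
  rw [hpoles]
  rintro ⟨n, rfl⟩
  have hnm : (n : ℤ) = m := natCast_eq_of_norm_sub_lt_one (β := β) <| by
    simpa only [mem_ball_iff_norm, Int.cast_natCast] using hω.1
  exact hω.2 (by rw [Int.natCast_inj.1 hnm]; rfl)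

lemma differentiableOn_meijerKernel (hpoles : meijerPoles b S = range fun m : ℕ => β + m) (m : ℕ) :
    DifferentiableOn ℂ (meijerKernel b S) (ball (β + m) 1 \ {β + (m : ℂ)}) := fun _ hω =>
  (differentiableAt_meijerKernel
    (notMem_meijerPoles_of_mem_punctured_ball hpoles hω)).differentiableWithinAt

lemma differentiableOn_meijerKernel_closedBall_sub_one
    (hpoles : meijerPoles b S = range fun m : ℕ => β + m) :
    DifferentiableOn ℂ (meijerKernel b S) (closedBall (β - 1) (1 / 2)) := by
  refine fun ω hω => (differentiableAt_meijerKernel ?_).differentiableWithinAt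
  rw [hpoles]
  rintro ⟨n, rfl⟩
  have hn : (n : ℤ) = -1 := by
    refine natCast_eq_of_norm_sub_lt_one (β := β) ?_
    rw [mem_closedBall_iff_norm] at hω
    push_cast
    exact hω.trans_lt (by norm_num)
  omega

lemma sphere_subset_punctured_ball (a : ℂ) : sphere a (1 / 2) ⊆ ball a 1 \ {a} := fun ω hω =>
  ⟨sphere_subset_ball (by norm_num) hω, ne_of_mem_sphere hω (by norm_num)⟩

lemma add_one_mem_sphere {ω : ℂ} {m : ℕ} (hω : ω ∈ sphere (β + m) (1 / 2)) :
    ω + 1 ∈ sphere (β + (m + 1 : ℕ)) (1 / 2) := by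
  rw [mem_sphere_iff_norm] at hω ⊢
  rw [← hω]
  push_cast
  ring_nf

lemma le_norm_add_one_sub {c ω : ℂ} {m : ℕ} (hω : ω ∈ sphere (β + m) (1 / 2)) :
    m - (1 / 2 + ‖β + 1 - c‖) ≤ ‖ω + 1 - c‖ := by
  have htri : ‖(m : ℂ)‖ ≤ ‖ω + 1 - c‖ + (‖ω - (β + m)‖ + ‖β + 1 - c‖) := by
    refine le_trans (le_of_eq ?_) ((norm_sub_le _ _).trans (add_le_add_right (norm_add_le _ _) _))
    ring_nf
  rw [norm_natCast, mem_sphere_iff_norm.1 hω] at htri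
  linarith

lemma rapidlyDecaying_meijerKernel (hq : 1 ≤ q)
    (hpoles : meijerPoles b S = range fun m : ℕ => β + m) :
    RapidlyDecaying (meijerKernel b S) β := by
  refine rapidlyDecaying_of_norm_add_one_le (fun m =>
    (differentiableOn_meijerKernel hpoles m).continuousOn.mono (sphere_subset_punctured_ball _))
    fun R => ?_
  have hfar : ∀ᶠ m : ℕ in atTop, ∀ i, max R 1 + (1 / 2 + ‖β + 1 - b i‖) ≤ m :=
    eventually_all.2 fun i => tendsto_natCast_atTop_atTop.eventually_ge_atTop _
  filter_upwards [hfar] with m hm ω hω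
  have hω' : ω + 1 ∉ meijerPoles b S := notMem_meijerPoles_of_mem_punctured_ball hpoles
    (sphere_subset_punctured_ball _ (add_one_mem_sphere hω))
  have hfactor : max R 1 ≤ ∏ i, ‖ω + 1 - b i‖ :=
    calc max R 1 ≤ max R 1 ^ q := le_self_pow₀ (le_max_right _ _) (by omega)
      _ = ∏ _i : Fin q, max R 1 := by simp
      _ ≤ ∏ i, ‖ω + 1 - b i‖ := Finset.prod_le_prod (fun _ _ => by positivity) fun i _ => by
          linarith [hm i, le_norm_add_one_sub (c := b i) hω]
  calc R * ‖meijerKernel b S (ω + 1)‖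
      ≤ (∏ i, ‖ω + 1 - b i‖) * ‖meijerKernel b S (ω + 1)‖ := by
        gcongr
        exact (le_max_left _ _).trans hfactor
    _ = ‖meijerKernel b S ω‖ := by
        rw [← norm_prod, ← norm_mul, prod_mul_meijerKernel_add_one hω']
        simp

lemma residue_meijerIntegrand (hpoles : meijerPoles b S = range fun m : ℕ => β + m) (m : ℕ)
    (t : ℂ) :
    residue (meijerIntegrand b S t) (β + m) = contourTerm (meijerKernel b S) (β + m) t := by
  simp only [funext (meijerIntegrand_eq b S t), contourTerm]
  exact residue_eq ((differentiableOn_meijerKernel hpoles m).mul (by fun_prop)) (by norm_num)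
    (by norm_num)

/-- The poles, numbered by the natural numbers. -/
def polesEquiv (hpoles : meijerPoles b S = range fun m : ℕ => β + m) : ℕ ≃ meijerPoles b S :=
  (Equiv.ofInjective (fun m : ℕ => β + m) fun m n h => by simpa using h).trans
    (Equiv.setCongr hpoles.symm)

lemma coe_polesEquiv (hpoles : meijerPoles b S = range fun m : ℕ => β + m) (m : ℕ) :
    (polesEquiv hpoles m : ℂ) = β + m := rfl

lemma summable_norm_residue (hq : 1 ≤ q) (hpoles : meijerPoles b S = range fun m : ℕ => β + m)
    (t : ℂ) :
    Summable fun ω : meijerPoles b S => ‖residue (meijerIntegrand b S t) (ω : ℂ)‖ := by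
  rw [← (polesEquiv hpoles).summable_iff]
  simpa only [Function.comp_def, coe_polesEquiv, residue_meijerIntegrand hpoles] using
    (rapidlyDecaying_meijerKernel hq hpoles).summable_norm_contourTerm t

lemma meijerG_eq_neg_mellinBarnes (hpoles : meijerPoles b S = range fun m : ℕ => β + m) (t : ℂ) :
    meijerG b S t = -mellinBarnes (meijerKernel b S) β t := by
  simp only [meijerG, ← (polesEquiv hpoles).tsum_eq, coe_polesEquiv,
    residue_meijerIntegrand hpoles, mellinBarnes]

lemma differentiable_meijerG (hq : 1 ≤ q) (hpoles : meijerPoles b S = range fun m : ℕ => β + m) :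
    Differentiable ℂ (meijerG b S) := fun t => by
  rw [funext (meijerG_eq_neg_mellinBarnes hpoles)]
  exact ((rapidlyDecaying_meijerKernel hq hpoles).hasDerivAt_mellinBarnes t).neg.differentiableAt

end meijerKernel

section euler

variable {q : ℕ} {b : Fin q → ℂ} {U : Set ℂ} {u v : ℂ → ℂ}

lemma eulerFactor_eqOn (hU : IsOpen U) (h : EqOn u v U) (c : ℂ) :
    EqOn (eulerFactor c u) (eulerFactor c v) U := fun ζ hζ => by
  rw [eulerFactor, eulerFactor, h.deriv hU hζ, h hζ]

lemma eulerFactor_smul (c a : ℂ) (u : ℂ → ℂ) :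
    eulerFactor c (a • u) = a • eulerFactor c u := by
  funext ζ
  simp only [eulerFactor, deriv_const_smul_field, Pi.smul_apply, smul_eq_mul]
  ring

lemma eulerFactor_add {ζ : ℂ} (hu : DifferentiableAt ℂ u ζ) (hv : DifferentiableAt ℂ v ζ) (c : ℂ) :
    eulerFactor c (u + v) ζ = eulerFactor c u ζ + eulerFactor c v ζ := by
  simp only [eulerFactor, deriv_add hu hv, Pi.add_apply]
  ring

lemma differentiableOn_foldr_eulerFactor (hU : IsOpen U) (hu : DifferentiableOn ℂ u U)
    (l : List ℂ) : DifferentiableOn ℂ (l.foldr eulerFactor u) U := by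
  induction l with
  | nil => exact hu
  | cons c l ih => exact (differentiableOn_id.mul (ih.deriv hU)).sub (ih.const_mul c)

lemma foldr_eulerFactor_smul (a : ℂ) (u : ℂ → ℂ) (l : List ℂ) :
    l.foldr eulerFactor (a • u) = a • l.foldr eulerFactor u := by
  induction l with
  | nil => rfl
  | cons c l ih => simp only [List.foldr_cons, ih, eulerFactor_smul]

lemma foldr_eulerFactor_add (hU : IsOpen U) (hu : DifferentiableOn ℂ u U)
    (hv : DifferentiableOn ℂ v U) (l : List ℂ) :
    EqOn (l.foldr eulerFactor (u + v)) (l.foldr eulerFactor u + l.foldr eulerFactor v) U := by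
  induction l with
  | nil => exact fun _ _ => rfl
  | cons c l ih =>
    intro ζ hζ
    have hd {w : ℂ → ℂ} (hw : DifferentiableOn ℂ w U) :
        DifferentiableAt ℂ (l.foldr eulerFactor w) ζ :=
      (differentiableOn_foldr_eulerFactor hU hw l).differentiableAt (hU.mem_nhds hζ)
    exact (eulerFactor_eqOn hU ih c hζ).trans (eulerFactor_add (hd hu) (hd hv) c)

/-- The space of solutions on `U`, as functions on `ℂ` whose values outside `U` do not matter. -/
def solutionSubmodule (b : Fin q → ℂ) (hU : IsOpen U) : Submodule ℂ (ℂ → ℂ) where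
  carrier := {u | IsSolution b U u}
  add_mem' {u v} hu hv := ⟨hu.1.add hv.1, fun ζ hζ => by
    have hadd := foldr_eulerFactor_add hU hu.1 hv.1 (List.ofFn b) hζ
    rw [eulerProd, hadd, Pi.add_apply, Pi.add_apply, ← eulerProd, ← eulerProd]
    linear_combination hu.2 ζ hζ + hv.2 ζ hζ⟩
  zero_mem' := ⟨differentiableOn_const 0, fun ζ _ => by
    have hzero := congrFun (foldr_eulerFactor_smul 0 0 (List.ofFn b)) ζ
    rw [zero_smul, zero_smul] at hzero
    rw [eulerProd, hzero]
    simp⟩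
  smul_mem' a u hu := ⟨hu.1.const_smul a, fun ζ hζ => by
    rw [eulerProd, foldr_eulerFactor_smul, ← eulerProd, Pi.smul_apply, Pi.smul_apply, smul_eq_mul,
      smul_eq_mul]
    linear_combination a * hu.2 ζ hζ⟩

lemma analyticOrderAt_eulerFactor {x : ℂ} (hx : x ≠ 0) (hu : AnalyticAt ℂ u x) (c : ℂ) {n : ℕ}
    (hn : analyticOrderAt u x = (n + 1 : ℕ)) : analyticOrderAt (eulerFactor c u) x = n := by
  have hux : u x = 0 := apply_eq_zero_of_analyticOrderAt_ne_zero (by simp [hn])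
  have hderiv : analyticOrderAt (deriv u) x = n := by
    have h := hu.analyticOrderAt_deriv_add_one
    simp only [hux, sub_zero] at h
    rw [show (fun ζ => u ζ) = u from rfl, hn, Nat.cast_add, Nat.cast_one] at h
    exact ENat.add_left_injective_of_ne_top (by simp) h
  have hmain : analyticOrderAt (id * deriv u) x = n := by
    rw [analyticOrderAt_mul analyticAt_id hu.deriv, hderiv,
      analyticAt_id.analyticOrderAt_eq_zero.2 (by simpa using hx), zero_add]
  have hlower : (n : ℕ∞) < analyticOrderAt ((fun _ => -c) * u) x := by
    rw [analyticOrderAt_mul analyticAt_const hu, hn]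
    exact lt_of_lt_of_le (mod_cast n.lt_succ_self) le_add_self
  have hsplit : eulerFactor c u = id * deriv u + (fun _ => -c) * u := by
    funext ζ
    simp [eulerFactor, sub_eq_add_neg]
  rw [hsplit, analyticOrderAt_add_eq_left_of_lt (by rwa [hmain]), hmain]

lemma analyticOrderAt_foldr_eulerFactor {x : ℂ} (hx : x ≠ 0) (hu : AnalyticAt ℂ u x)
    (l : List ℂ) (n : ℕ) (hn : analyticOrderAt u x = (n + l.length : ℕ)) :
    AnalyticAt ℂ (l.foldr eulerFactor u) x ∧ analyticOrderAt (l.foldr eulerFactor u) x = n := by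
  induction l generalizing n with
  | nil => exact ⟨hu, by simpa using hn⟩
  | cons c l ih =>
    obtain ⟨han, hord⟩ := ih (n + 1) (by rw [hn, List.length_cons]; congr 1; omega)
    exact ⟨(analyticAt_id.mul han.deriv).sub (analyticAt_const.mul han),
      analyticOrderAt_eulerFactor hx han c hord⟩

/-- At a point `x ≠ 0` each Euler factor lowers the order of vanishing by exactly one, whereas
multiplication by `ζ` preserves it; so a solution that vanishes to a finite order `N ≥ q` would give
`N - q = N`. -/
lemma IsSolution.eqOn_zero (hq : 1 ≤ q) (hU : IsOpen U) (hUc : IsPreconnected U)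
    (hu : IsSolution b U u) {x : ℂ} (hxU : x ∈ U) (hx : x ≠ 0)
    (hjet : ∀ k < q, iteratedDeriv k u x = 0) : EqOn u 0 U := by
  have han : AnalyticOnNhd ℂ u U := hu.1.analyticOnNhd hU
  have hux := han x hxU
  have hq_le : (q : ℕ∞) ≤ analyticOrderAt u x :=
    (natCast_le_analyticOrderAt_iff_iteratedDeriv_eq_zero hux).2 hjet
  suffices htop : analyticOrderAt u x = ⊤ from
    han.eqOn_of_preconnected_of_eventuallyEq (fun _ _ => analyticAt_const) hUc hxU
      (analyticOrderAt_eq_top.1 htop)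
  by_contra hfinite
  obtain ⟨N, hN⟩ := ENat.ne_top_iff_exists.1 hfinite
  have hqN : q ≤ N := by rw [← hN] at hq_le; exact_mod_cast hq_le
  have hleft : analyticOrderAt (eulerProd b u) x = (N - q : ℕ) :=
    (analyticOrderAt_foldr_eulerFactor hx hux (List.ofFn b) (N - q)
      (by rw [← hN, List.length_ofFn, Nat.sub_add_cancel hqN])).2
  have hright : analyticOrderAt (id * u) x = N := by
    rw [analyticOrderAt_mul analyticAt_id hux, ← hN,
      analyticAt_id.analyticOrderAt_eq_zero.2 (by simpa using hx), zero_add]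
  have heq : eulerProd b u =ᶠ[𝓝 x] id * u := by
    filter_upwards [hU.mem_nhds hxU] with ζ hζ using sub_eq_zero.1 (hu.2 ζ hζ)
  have hN' : N - q = N := by
    exact_mod_cast hleft.symm.trans ((analyticOrderAt_congr heq).trans hright)
  omega

/-- The initial data of a solution at a point `x` of `U`: the derivatives of order `0, …, q - 1`. -/
def initialData (b : Fin q → ℂ) (hU : IsOpen U) {x : ℂ} (hx : x ∈ U) :
    solutionSubmodule b hU →ₗ[ℂ] Fin q → ℂ where
  toFun u k := iteratedDeriv k u x
  map_add' u v := by
    have hcd (w : solutionSubmodule b hU) (k : Fin q) : ContDiffAt ℂ k (w : ℂ → ℂ) x :=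
      (w.2.1.analyticOnNhd hU x hx).contDiffAt
    funext k
    exact iteratedDeriv_add (hcd u k) (hcd v k)
  map_smul' a u := by
    funext k
    exact iteratedDeriv_const_smul_field a (u : ℂ → ℂ)

lemma isFundamentalSystem_of_linearIndependent (hq : 1 ≤ q) (hU : IsOpen U)
    (hUc : IsConnected U) (hU0 : (0 : ℂ) ∉ U) {y : Fin q → ℂ → ℂ}
    (hy : ∀ j, IsSolution b U (y j)) (hli : LinearIndependent ℂ fun j => fun ζ : U => y j ζ) :
    IsFundamentalSystem b U y := by
  obtain ⟨x, hxU⟩ := hUc.nonempty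
  let y' : Fin q → solutionSubmodule b hU := fun j => ⟨y j, hy j⟩
  have huniq (u : solutionSubmodule b hU) (hu : initialData b hU hxU u = 0) :
      EqOn (u : ℂ → ℂ) 0 U :=
    u.2.eqOn_zero hq hU hUc.isPreconnected hxU (ne_of_mem_of_not_mem hxU hU0)
      fun k hk => congrFun hu ⟨k, hk⟩
  have hdata : LinearIndependent ℂ fun j => initialData b hU hxU (y' j) := by
    refine Fintype.linearIndependent_iff.2 fun a ha => Fintype.linearIndependent_iff.1 hli a ?_
    have hzero : initialData b hU hxU (∑ j, a j • y' j) = 0 := by simpa only [map_sum, map_smul]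
    funext ζ
    simpa [y'] using huniq _ hzero ζ.2
  refine ⟨hy, hli, fun u hu => ?_⟩
  have hspan := hdata.span_eq_top_of_card_eq_finrank' (by simp)
  obtain ⟨a, ha⟩ := (Submodule.mem_span_range_iff_exists_fun ℂ).1
    (hspan.symm ▸ Submodule.mem_top : initialData b hU hxU ⟨u, hu⟩ ∈ Submodule.span ℂ (range _))
  have hzero : initialData b hU hxU (⟨u, hu⟩ - ∑ j, a j • y' j) = 0 := by
    rw [map_sub, map_sum, ← ha, sub_eq_zero]
    simp only [map_smul]
  refine ⟨a, fun ζ hζ => sub_eq_zero.1 ?_⟩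
  simpa [y'] using huniq _ hzero hζ

lemma hasDerivAt_log_branch (hU : IsOpen U) {L : ℂ → ℂ} (hL : ContinuousOn L U) {ε : ℂ}
    (hε : ε ≠ 0) (hexp : ∀ ζ ∈ U, cexp (L ζ) = ε * ζ) {ζ : ℂ} (hζ : ζ ∈ U) :
    HasDerivAt L ζ⁻¹ ζ := by
  have hζ₀ : ζ ≠ 0 := by
    rintro rfl
    simpa using hexp 0 hζ
  have hinv : HasDerivAt (fun t => ε⁻¹ * cexp t) ζ (L ζ) := by
    simpa only [hexp ζ hζ, inv_mul_cancel_left₀ hε] using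
      (Complex.hasDerivAt_exp (L ζ)).const_mul ε⁻¹
  refine HasDerivAt.of_local_left_inverse (hL.continuousAt (hU.mem_nhds hζ)) hinv hζ₀ ?_
  filter_upwards [hU.mem_nhds hζ] with ξ hξ
  rw [hexp ξ hξ, inv_mul_cancel_left₀ hε]

lemma eulerFactor_comp_log {F L : ℂ → ℂ} {F' ζ : ℂ} (hζ : ζ ≠ 0) (hL : HasDerivAt L ζ⁻¹ ζ)
    (hF : HasDerivAt F F' (L ζ)) (c : ℂ) :
    eulerFactor c (F ∘ L) ζ = F' - c * F (L ζ) := by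
  rw [eulerFactor, (hF.comp ζ hL).deriv, Function.comp_apply]
  field_simp

lemma foldr_eulerFactor_mellinBarnes (hU : IsOpen U) {L : ℂ → ℂ} (hU0 : (0 : ℂ) ∉ U)
    (hL : ∀ ζ ∈ U, HasDerivAt L ζ⁻¹ ζ) {M : ℂ → ℂ} {β : ℂ} (hM : RapidlyDecaying M β)
    (l : List ℂ) :
    EqOn (l.foldr eulerFactor (mellinBarnes M β ∘ L))
      (mellinBarnes (fun ω => (l.map (ω - ·)).prod * M ω) β ∘ L) U := by
  induction l with
  | nil => simp [EqOn]
  | cons c l ih =>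
    intro ζ hζ
    have hMl := hM.list_prod_mul l
    rw [List.foldr_cons, eulerFactor_eqOn hU ih c hζ,
      eulerFactor_comp_log (ne_of_mem_of_not_mem hζ hU0) (hL ζ hζ) (hMl.hasDerivAt_mellinBarnes _),
      ← mellinBarnes_sub_const_mul hMl]
    simp only [List.map_cons, List.prod_cons, mul_assoc, Function.comp_apply]

/-- Shifting the contour by one unit turns `∏ (ω - b i)` times the kernel into multiplication by
`± exp t`. The only term that this leaves over, at `β - 1`, vanishes since the kernel is holomorphic
there. -/
lemma mellinBarnes_prod_mul_meijerKernel (hq : 1 ≤ q) {S : Finset (Fin q)} {β : ℂ}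
    (hpoles : meijerPoles b S = range fun m : ℕ => β + m) (t : ℂ) :
    mellinBarnes (fun ω => (∏ i, (ω - b i)) * meijerKernel b S ω) β t =
      (-1) ^ S.card * cexp t * mellinBarnes (meijerKernel b S) β t := by
  have hrec (m : ℕ) : EqOn (fun ω => (∏ i, (ω + 1 - b i)) * meijerKernel b S (ω + 1))
      (fun ω => (-1) ^ S.card * meijerKernel b S ω) (sphere (β - 1 + m) (1 / 2)) := by
    refine fun ω hω => prod_mul_meijerKernel_add_one <|
      notMem_meijerPoles_of_mem_punctured_ball hpoles <|
      sphere_subset_punctured_ball (β + m) ?_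
    convert add_one_mem_sphere hω using 2
    push_cast
    ring
  have hM : RapidlyDecaying (meijerKernel b S) (β - 1 + 1) := by
    rw [sub_add_cancel]
    exact rapidlyDecaying_meijerKernel hq hpoles
  calc mellinBarnes (fun ω => (∏ i, (ω - b i)) * meijerKernel b S ω) β t
      = cexp t *
          mellinBarnes (fun ω => (∏ i, (ω + 1 - b i)) * meijerKernel b S (ω + 1)) (β - 1) t := by
        rw [← mellinBarnes_add_one (fun ω => (∏ i, (ω - b i)) * meijerKernel b S ω),
          sub_add_cancel]
    _ = (-1) ^ S.card * cexp t * mellinBarnes (meijerKernel b S) (β - 1) t := by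
        rw [mellinBarnes_congr hrec, mellinBarnes_const_mul]
        ring
    _ = (-1) ^ S.card * cexp t * mellinBarnes (meijerKernel b S) β t := by
        rw [hM.mellinBarnes_eq_add,
          contourTerm_eq_zero (differentiableOn_meijerKernel_closedBall_sub_one hpoles), zero_add,
          sub_add_cancel]

lemma isSolution_meijerG (hq : 1 ≤ q) {S : Finset (Fin q)} {β : ℂ}
    (hpoles : meijerPoles b S = range fun m : ℕ => β + m) (hU : IsOpen U) (hU0 : (0 : ℂ) ∉ U)
    {L : ℂ → ℂ} (hLc : ContinuousOn L U) (hL : ∀ ζ ∈ U, cexp (L ζ) = (-1) ^ S.card * ζ) :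
    IsSolution b U fun ζ => meijerG b S (L ζ) := by
  have hM := rapidlyDecaying_meijerKernel hq hpoles
  have hL' : ∀ ζ ∈ U, HasDerivAt L ζ⁻¹ ζ := fun _ => hasDerivAt_log_branch hU hLc (by simp) hL
  suffices h : IsSolution b U (mellinBarnes (meijerKernel b S) β ∘ L) by
    simp only [meijerG_eq_neg_mellinBarnes hpoles]
    exact (solutionSubmodule b hU).neg_mem h
  refine ⟨fun ζ hζ => ((hM.hasDerivAt_mellinBarnes _).comp ζ
    (hL' ζ hζ)).differentiableAt.differentiableWithinAt, fun ζ hζ => ?_⟩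
  have hprod := foldr_eulerFactor_mellinBarnes hU hU0 hL' hM (List.ofFn b) hζ
  simp only [List.map_ofFn, List.prod_ofFn, Function.comp_apply,
    mellinBarnes_prod_mul_meijerKernel hq hpoles, hL ζ hζ] at hprod
  rw [eulerProd, hprod, ← mul_assoc ((-1) ^ S.card), ← mul_pow, Function.comp_apply]
  simp

end euler

section poles

variable {M φ : ℂ → ℂ} {a β : ℂ}

lemma contourTerm_of_pole (hφ : DifferentiableOn ℂ φ (ball a 1)) (k : ℕ)
    (hM : EqOn M (fun ω => ((ω - a) ^ (k + 1))⁻¹ * φ ω) (sphere a (1 / 2))) (t : ℂ) :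
    contourTerm M a t = cexp (a * t) * ((k.factorial : ℂ)⁻¹ *
      ∑ i ∈ Finset.range (k + 1), k.choose i * iteratedDeriv i φ a * t ^ (k - i)) := by
  have ha : ball a 1 ∈ 𝓝 a := ball_mem_nhds a one_pos
  have hcauchy := DifferentiableOn.circleIntegral_one_div_sub_center_pow_smul
    (f := fun ω => φ ω * cexp (t * ω)) (by norm_num : (0 : ℝ) < 1 / 2) k
    ((hφ.mul (by fun_prop)).mono (closedBall_subset_ball (by norm_num)))
  have hleibniz : iteratedDeriv k (fun ω => φ ω * cexp (t * ω)) a =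
      cexp (a * t) *
        ∑ i ∈ Finset.range (k + 1), k.choose i * iteratedDeriv i φ a * t ^ (k - i) := by
    rw [iteratedDeriv_fun_mul (hφ.analyticAt ha).contDiffAt (by fun_prop), Finset.mul_sum]
    refine Finset.sum_congr rfl fun i _ => ?_
    simp only [iteratedDeriv_cexp_const_mul, mul_comm t a]
    ring
  simp only [one_div, smul_eq_mul, ← mul_assoc, mul_comm t] at hcauchy
  rw [contourTerm_congr hM, contourTerm, mul_left_comm (cexp _), ← hleibniz,
    inv_mul_eq_iff_eq_mul₀ two_pi_I_ne_zero]
  simp only [one_div, mul_comm t, hcauchy]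
  ring

lemma tendsto_sum_mul_pow_div_pow (c : ℕ → ℂ) (k : ℕ) :
    Tendsto (fun t : ℂ => (∑ i ∈ Finset.range (k + 1), c i * t ^ (k - i)) / t ^ k)
      (cobounded ℂ) (𝓝 (c 0)) := by
  have hterm : ∀ i ∈ Finset.range (k + 1),
      Tendsto (fun t : ℂ => c i * t⁻¹ ^ i) (cobounded ℂ) (𝓝 (c i * 0 ^ i)) := fun i _ =>
    (tendsto_inv₀_cobounded.pow i).const_mul (c i)
  have hsum := tendsto_finsetSum _ hterm
  rw [Finset.sum_eq_single_of_mem 0 (by simp) (by simp +contextual), pow_zero, mul_one] at hsum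
  refine hsum.congr' ?_
  filter_upwards [eventually_ne_cobounded (0 : ℂ)] with t ht
  rw [Finset.sum_div]
  refine Finset.sum_congr rfl fun i hi => ?_
  rw [pow_sub₀ t ht (Finset.mem_range_succ_iff.1 hi), inv_pow]
  field_simp

/-- The monomial `z ^ β (log z) ^ d`, as a function of `t = log z`. -/
def logMonomial (β : ℂ) (d : ℕ) (t : ℂ) : ℂ :=
  cexp (β * t) * t ^ d

/-- The filter of the limit `|z| → 0` with `|arg z| ≤ A`, in terms of `t = log z`. -/
abbrev leftStrip (A : ℝ) : Filter ℂ :=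
  comap re atBot ⊓ 𝓟 {t | |t.im| ≤ A}

lemma tendsto_re_leftStrip (A : ℝ) : Tendsto re (leftStrip A) atBot :=
  tendsto_comap.mono_left inf_le_left

lemma leftStrip_le_cobounded (A : ℝ) : leftStrip A ≤ cobounded ℂ :=
  tendsto_id'.1 <| tendsto_norm_atTop_iff_cobounded.1 <|
    tendsto_atTop_mono (fun t => (neg_le_abs t.re).trans (abs_re_le_norm t))
      (tendsto_neg_atBot_atTop.comp (tendsto_re_leftStrip A))

lemma tendsto_mellinBarnes_add_one_div (hM : RapidlyDecaying M (β + 1)) (k : ℕ) (A : ℝ) :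
    Tendsto (fun t => mellinBarnes M (β + 1) t / logMonomial β k t) (leftStrip A) (𝓝 0) := by
  obtain ⟨K, hK⟩ := hM.exists_norm_mellinBarnes_le
  have hdecay : Tendsto (fun t : ℂ => |K| * Real.exp ((t.re + A) / 2)) (leftStrip A) (𝓝 0) := by
    have hexp := Real.tendsto_exp_atBot.comp
      ((tendsto_atBot_add_const_right _ A (tendsto_re_leftStrip A)).atBot_div_const two_pos)
    simpa using hexp.const_mul |K|
  refine squeeze_zero_norm' ?_ hdecay
  filter_upwards [(tendsto_re_leftStrip A).eventually_le_atBot (min 0 (-1)),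
    mem_inf_of_right (mem_principal_self _)] with t ht (him : |t.im| ≤ A)
  obtain ⟨hre, hre₁⟩ := le_min_iff.1 ht
  have hnorm : ‖t‖ ≤ -t.re + A := by
    have h := norm_le_abs_re_add_abs_im t
    rw [abs_of_nonpos hre] at h
    linarith
  have hone : 1 ≤ ‖t‖ ^ k := one_le_pow₀ (by linarith [neg_le_abs t.re, abs_re_le_norm t])
  have hpos : 0 < ‖cexp (β * t)‖ * ‖t‖ ^ k :=
    mul_pos (norm_pos_iff.2 (Complex.exp_ne_zero _)) (one_pos.trans_le hone)
  rw [norm_div, logMonomial, norm_mul, norm_pow, div_le_iff₀ hpos]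
  calc ‖mellinBarnes M (β + 1) t‖
      ≤ K * (‖cexp ((β + 1) * t)‖ * Real.exp (‖t‖ / 2)) := hK t hre
    _ ≤ |K| * (‖cexp ((β + 1) * t)‖ * Real.exp (‖t‖ / 2)) := by gcongr; exact le_abs_self K
    _ = |K| * (‖cexp (β * t)‖ * Real.exp (t.re + ‖t‖ / 2)) := by
        rw [add_mul, one_mul, Complex.exp_add, norm_mul, norm_exp t, mul_assoc, Real.exp_add]
    _ ≤ |K| * (‖cexp (β * t)‖ * Real.exp ((t.re + A) / 2)) := by gcongr; linarith
    _ = |K| * Real.exp ((t.re + A) / 2) * (‖cexp (β * t)‖ * 1) := by ring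
    _ ≤ |K| * Real.exp ((t.re + A) / 2) * (‖cexp (β * t)‖ * ‖t‖ ^ k) := by gcongr

lemma tendsto_mellinBarnes_div (hM : RapidlyDecaying M β) (hφ : DifferentiableOn ℂ φ (ball β 1))
    (k : ℕ) (hpole : EqOn M (fun ω => ((ω - β) ^ (k + 1))⁻¹ * φ ω) (sphere β (1 / 2))) (A : ℝ) :
    Tendsto (fun t => mellinBarnes M β t / logMonomial β k t) (leftStrip A)
      (𝓝 ((k.factorial : ℂ)⁻¹ * φ β)) := by
  have hlead := ((tendsto_sum_mul_pow_div_pow (fun i => k.choose i * iteratedDeriv i φ β)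
    k).mono_left (leftStrip_le_cobounded A)).const_mul (k.factorial : ℂ)⁻¹
  have hlim := hlead.add (tendsto_mellinBarnes_add_one_div hM.add_one k A)
  simp only [Nat.choose_zero_right, Nat.cast_one, one_mul, iteratedDeriv_zero, add_zero] at hlim
  refine hlim.congr fun t => ?_
  rw [hM.add_one.mellinBarnes_eq_add, contourTerm_of_pole hφ k hpole, add_div, logMonomial,
    mul_div_mul_left _ _ (Complex.exp_ne_zero _), mul_div_assoc]

lemma exists_Gamma_eq_inv_mul (m : ℕ) :
    ∃ ψ : ℂ → ℂ, DifferentiableOn ℂ ψ (ball (-m) 1) ∧ ψ (-m) = (-1) ^ m / m.factorial ∧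
      ∀ s ∈ ball (-m : ℂ) 1 \ {-(m : ℂ)}, Gamma s = (s + m)⁻¹ * ψ s := by
  induction m with
  | zero =>
    refine ⟨fun s => Gamma (s + 1), fun s hs => ?_, by simp, fun s hs => ?_⟩
    · have hΓ : DifferentiableAt ℂ Gamma (s + 1) := by
        refine differentiableAt_Gamma _ fun n hn => ?_
        rw [Nat.cast_zero, neg_zero, mem_ball_zero_iff, eq_sub_of_add_eq hn, ← neg_add', norm_neg]
          at hs
        norm_cast at hs
      exact (hΓ.comp s (by fun_prop)).differentiableWithinAt
    · have hs₀ : s ≠ 0 := by simpa using hs.2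
      simp only [Nat.cast_zero, add_zero, Gamma_add_one s hs₀, inv_mul_cancel_left₀ hs₀]
  | succ m ih =>
    obtain ⟨ψ, hψ, hψm, hΓ⟩ := ih
    have hmaps : MapsTo (fun s : ℂ => s + 1) (ball (-(m + 1 : ℕ)) 1) (ball (-m) 1) := fun s hs => by
      rw [mem_ball_iff_norm] at hs ⊢
      convert hs using 2
      push_cast
      ring
    have hne {s : ℂ} (hs : s ∈ ball (-(m + 1 : ℕ) : ℂ) 1) : s ≠ 0 := by
      rintro rfl
      rw [mem_ball_iff_norm, zero_sub, neg_neg, Complex.norm_natCast] at hs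
      norm_cast at hs
    refine ⟨fun s => s⁻¹ * ψ (s + 1),
      (differentiableOn_id.inv fun s hs => hne hs).mul (hψ.comp (by fun_prop) hmaps), ?_,
      fun s hs => ?_⟩
    · have hcenter : -((m + 1 : ℕ) : ℂ) + 1 = -m := by push_cast; ring
      simp only [hcenter, hψm, Nat.factorial_succ, pow_succ]
      push_cast
      have hm : (m + 1 : ℂ) ≠ 0 := m.cast_add_one_ne_zero
      field_simp
    · have hs₁ : s + 1 ≠ -m := fun h => hs.2 <| by
        rw [mem_singleton_iff]; push_cast; linear_combination h
      have hΓs := hΓ (s + 1) ⟨hmaps hs.1, hs₁⟩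
      rw [Gamma_add_one s (hne hs.1)] at hΓs
      rw [← inv_mul_cancel_left₀ (hne hs.1) (Gamma s), hΓs]
      push_cast
      ring

end poles

section kernelPoles

variable {q : ℕ} {b : Fin q → ℂ} {S : Finset (Fin q)} {β : ℂ}

lemma exists_Gamma_sub_eq (β : ℂ) (n : ℕ) :
    ∃ φ : ℂ → ℂ, DifferentiableOn ℂ φ (ball β 1) ∧ φ β ≠ 0 ∧ ∀ ω ∈ ball β 1 \ {β},
      Gamma (β + n - ω) = (if β + n = β then (ω - β)⁻¹ else 1) * φ ω := by
  rcases n.eq_zero_or_pos with rfl | hn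
  · obtain ⟨ψ, hψ, hψ₀, hΓ⟩ := exists_Gamma_eq_inv_mul 0
    simp only [Nat.cast_zero, neg_zero, add_zero, pow_zero, Nat.factorial_zero, Nat.cast_one,
      div_one] at hψ hψ₀ hΓ
    have hmaps : MapsTo (β - ·) (ball β 1) (ball 0 1) := fun ω hω => by
      rwa [mem_ball_zero_iff, norm_sub_rev, ← mem_ball_iff_norm]
    refine ⟨fun ω => -ψ (β - ω), (hψ.comp (by fun_prop) hmaps).neg, by simp [hψ₀], fun ω hω => ?_⟩
    have hne : β - ω ≠ 0 := sub_ne_zero.2 (Ne.symm hω.2)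
    simp only [Nat.cast_zero, add_zero, ↓reduceIte, hΓ _ ⟨hmaps hω.1, hne⟩]
    rw [← neg_sub β ω, inv_neg, neg_mul_neg]
  · refine ⟨fun ω => Gamma (β + n - ω), fun ω hω => ?_, ?_, fun ω _ => ?_⟩
    · have hΓ : DifferentiableAt ℂ Gamma (β + n - ω) := by
        refine differentiableAt_Gamma _ fun k hk => ?_
        have hω' : ω - β = (n + k : ℕ) := by push_cast; linear_combination -hk
        rw [mem_ball_iff_norm, hω', Complex.norm_natCast] at hω
        norm_cast at hω
        omega
      exact (hΓ.comp ω (by fun_prop)).differentiableWithinAt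
    · simp only [add_sub_cancel_left]
      exact Gamma_ne_zero_of_re_pos (by simpa using hn)
    · rw [if_neg (by simpa using hn.ne'), one_mul]

lemma exists_meijerKernel_eq (hS : ∀ i ∈ S, ∃ n : ℕ, b i = β + n)
    (hSc : ∀ i ∉ S, ∀ n : ℕ, b i ≠ β + (n + 1)) :
    ∃ φ : ℂ → ℂ, DifferentiableOn ℂ φ (ball β 1) ∧ φ β ≠ 0 ∧ ∀ ω ∈ ball β 1 \ {β},
      meijerKernel b S ω = ((ω - β) ^ (S.filter (b · = β)).card)⁻¹ * φ ω := by
  have hfactor : ∀ i ∈ S, ∃ φ : ℂ → ℂ, DifferentiableOn ℂ φ (ball β 1) ∧ φ β ≠ 0 ∧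
      ∀ ω ∈ ball β 1 \ {β}, Gamma (b i - ω) = (if b i = β then (ω - β)⁻¹ else 1) * φ ω := by
    intro i hi
    obtain ⟨n, hn⟩ := hS i hi
    simpa only [hn] using exists_Gamma_sub_eq β n
  choose! φ hφ hφ₀ hφeq using hfactor
  refine ⟨fun ω => (∏ i ∈ S, φ i ω) * ∏ i ∈ Sᶜ, (Gamma (1 - b i + ω))⁻¹,
    (DifferentiableOn.fun_finsetProd hφ).mul
      (differentiable_prod_inv_Gamma b Sᶜ).differentiableOn,
    mul_ne_zero (Finset.prod_ne_zero_iff.2 hφ₀) (Finset.prod_ne_zero_iff.2 fun i hi =>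
      inv_ne_zero (Gamma_ne_zero fun n hn => hSc i (Finset.mem_compl.1 hi) n
        (by linear_combination -hn))), fun ω hω => ?_⟩
  rw [meijerKernel, Finset.prod_congr rfl fun i hi => hφeq i hi ω hω, Finset.prod_mul_distrib,
    Finset.prod_ite, Finset.prod_const, Finset.prod_const_one, mul_one, inv_pow, mul_assoc]

lemma tendsto_meijerG (hq : 1 ≤ q) (hpoles : meijerPoles b S = range fun m : ℕ => β + m)
    (hSc : ∀ i ∉ S, ∀ n : ℕ, b i ≠ β + (n + 1)) {k : ℕ}
    (hk : (S.filter (b · = β)).card = k + 1) :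
    ∃ C : ℂ, C ≠ 0 ∧ ∀ A : ℝ,
      Tendsto (fun t => meijerG b S t / logMonomial β k t) (leftStrip A) (𝓝 C) := by
  have hS : ∀ i ∈ S, ∃ n : ℕ, b i = β + n := fun i hi => by
    have hi : b i ∈ meijerPoles b S := ⟨i, hi, 0, by simp⟩
    rw [hpoles] at hi
    exact hi.imp fun _ h => h.symm
  obtain ⟨φ, hφ, hφ₀, hφeq⟩ := exists_meijerKernel_eq hS hSc
  rw [hk] at hφeq
  refine ⟨-((k.factorial : ℂ)⁻¹ * φ β),
    neg_ne_zero.2 (mul_ne_zero (inv_ne_zero (mod_cast k.factorial_ne_zero)) hφ₀), fun A => ?_⟩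
  simpa only [meijerG_eq_neg_mellinBarnes hpoles, neg_div] using
    (tendsto_mellinBarnes_div (rapidlyDecaying_meijerKernel hq hpoles) hφ k
      (fun ω hω => hφeq ω (sphere_subset_punctured_ball β hω)) A).neg

lemma contourTerm_Gamma_sub_mul (β : ℂ) (m : ℕ) {f : ℂ → ℂ} (hf : Differentiable ℂ f) (t : ℂ) :
    contourTerm (fun ω => Gamma (β - ω) * f ω) (β + m) t =
      -(cexp ((β + m) * t) * ((-1) ^ m / m.factorial * f (β + m))) := by
  obtain ⟨ψ, hψ, hψm, hΓ⟩ := exists_Gamma_eq_inv_mul m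
  have hmaps : MapsTo (β - ·) (ball (β + m) 1) (ball (-m) 1) := fun ω hω => by
    rw [mem_ball_iff_norm] at hω
    rw [mem_ball_iff_norm']
    convert hω using 2
    ring
  have hpole : EqOn (fun ω => Gamma (β - ω) * f ω)
      (fun ω => ((ω - (β + m)) ^ (0 + 1))⁻¹ * (-ψ (β - ω) * f ω)) (sphere (β + m) (1 / 2)) := by
    intro ω hω
    obtain ⟨hω₁, hω₂⟩ := sphere_subset_punctured_ball _ hω
    have hne : β - ω ≠ -m := fun h => hω₂ (by rw [mem_singleton_iff]; linear_combination -h)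
    simp only [hΓ _ ⟨hmaps hω₁, hne⟩, zero_add, pow_one]
    rw [show β - ω + m = -(ω - (β + m)) by ring, inv_neg]
    ring
  rw [contourTerm_of_pole (φ := fun ω => -ψ (β - ω) * f ω)
    ((hψ.comp (by fun_prop) hmaps).neg.mul hf.differentiableOn) 0 hpole]
  simp [hψm]

lemma prod_compl_singleton_inv_Gamma {j : Fin q} (hj : ∀ i, ∀ n : ℕ, b i ≠ b j + (n + 1)) (m : ℕ) :
    ∏ i ∈ {j}ᶜ, (Gamma (1 - b i + (b j + m)))⁻¹ = (∏ i, Gamma (1 + b j - b i))⁻¹ *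
      (∏ i : {i // i ≠ j}, (ascPochhammer ℂ m).eval (1 + b j - b i))⁻¹ := by
  have hne (i : Fin q) (n : ℕ) : 1 + b j - b i ≠ -n := fun h =>
    hj i n (by linear_combination -h)
  have hGamma (i : Fin q) : Gamma (1 - b i + (b j + m)) =
      Gamma (1 + b j - b i) * (ascPochhammer ℂ m).eval (1 + b j - b i) := by
    rw [← Gamma_add_nat_div_Gamma_eq _ (hne i), mul_div_cancel₀ _ (Gamma_ne_zero (hne i))]
    ring_nf
  have hj₁ : Gamma (1 + b j - b j) = 1 := by rw [add_sub_cancel_right, Gamma_one]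
  rw [Fintype.prod_eq_mul_prod_compl j, hj₁, one_mul, ← mul_inv,
    ← Finset.prod_subtype {j}ᶜ (by simp) fun i => (ascPochhammer ℂ m).eval (1 + b j - b i),
    ← Finset.prod_mul_distrib, Finset.prod_inv_distrib]
  simp only [hGamma]

lemma meijerG_singleton {j : Fin q} (hj : ∀ i, ∀ n : ℕ, b i ≠ b j + (n + 1)) {t ζ : ℂ}
    (ht : cexp t = -ζ) :
    meijerG b {j} t = cexp (b j * t) / (∏ i, Gamma (1 + b j - b i)) *
      hypergeometricZeroF (fun i : {i // i ≠ j} => 1 + b j - b i) ζ := by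
  have hpoles : meijerPoles b {j} = range fun m : ℕ => b j + m := by
    ext ω
    simp [meijerPoles, eq_comm]
  have hkernel : meijerKernel b {j} =
      fun ω => Gamma (b j - ω) * ∏ i ∈ {j}ᶜ, (Gamma (1 - b i + ω))⁻¹ := by
    ext ω
    rw [meijerKernel, Finset.prod_singleton]
  rw [meijerG_eq_neg_mellinBarnes hpoles, mellinBarnes, hypergeometricZeroF, ← tsum_neg,
    ← tsum_mul_left]
  refine tsum_congr fun m => ?_
  have hexp : cexp ((b j + m) * t) * (-1) ^ m = cexp (b j * t) * ζ ^ m := by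
    rw [add_mul, Complex.exp_add, Complex.exp_nat_mul, ht, mul_assoc, ← mul_pow, neg_mul_neg,
      mul_one]
  rw [hkernel, contourTerm_Gamma_sub_mul _ _ (differentiable_prod_inv_Gamma b {j}ᶜ),
    prod_compl_singleton_inv_Gamma hj, neg_neg, div_mul_eq_mul_div, mul_div_assoc', ← mul_assoc,
    hexp]
  simp only [div_eq_mul_inv, mul_inv]
  ring

end kernelPoles

section linearIndependent

variable {ι : Type*}

lemma exists_exp_mul_I_ne {ν μ : ℝ} (h : ν ≠ μ) : ∃ x : ℝ, cexp (ν * I * x) ≠ cexp (μ * I * x) := by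
  refine ⟨Real.pi / (ν - μ), ?_⟩
  have hsub : (ν - μ : ℂ) ≠ 0 := sub_ne_zero.2 (mod_cast h)
  have hhalf : (ν * I * (Real.pi / (ν - μ) : ℝ) : ℂ) =
      μ * I * (Real.pi / (ν - μ) : ℝ) + Real.pi * I := by
    push_cast
    field_simp
    ring
  rw [hhalf, Complex.exp_add, exp_pi_mul_I, mul_neg_one]
  exact neg_ne_self.2 (Complex.exp_ne_zero _)

lemma eq_zero_of_tendsto_sum_mul_exp_mul_I {ν : ι → ℝ} {s : Finset ι} (hν : InjOn ν s) {A : ι → ℂ}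
    (hA : Tendsto (fun x : ℝ => ∑ j ∈ s, A j * cexp (ν j * I * x)) atBot (𝓝 0)) :
    ∀ j ∈ s, A j = 0 := by
  classical
  induction s using Finset.induction_on generalizing A with
  | empty => simp
  | insert i s hi ih =>
    rw [Finset.coe_insert, injOn_insert (by simpa using hi)] at hν
    have hs : ∀ j ∈ s, A j = 0 := by
      intro j hj
      obtain ⟨h, hh⟩ := exists_exp_mul_I_ne fun heq : ν j = ν i => hν.2 ⟨j, hj, heq⟩
      -- The difference `f (x + h) - exp (ν i * I * h) * f x` does not involve the frequency `ν i`.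
      have hdiff := (hA.comp (tendsto_atBot_add_const_right _ h tendsto_id)).sub
        (hA.const_mul (cexp (ν i * I * h)))
      simp only [mul_zero, sub_zero] at hdiff
      refine (mul_eq_zero.1 (ih hν.1
        (A := fun j => A j * (cexp (ν j * I * h) - cexp (ν i * I * h)))
        (hdiff.congr fun x => ?_) j hj)).resolve_right (sub_ne_zero.2 hh)
      simp only [Function.comp_def, id, Finset.sum_insert hi, mul_add, Finset.mul_sum, ofReal_add,
        Complex.exp_add]
      rw [add_sub_add_comm, ← Finset.sum_sub_distrib, sub_eq_zero.2 (by ring), zero_add]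
      exact Finset.sum_congr rfl fun j _ => by ring
    have hnorm (x : ℝ) : ‖∑ j ∈ insert i s, A j * cexp (ν j * I * x)‖ = ‖A i‖ := by
      rw [Finset.sum_insert hi, Finset.sum_eq_zero fun j hj => by rw [hs j hj, zero_mul], add_zero]
      simp [norm_exp]
    have hi₀ := hA.norm
    simp only [hnorm, norm_zero, tendsto_const_nhds_iff, norm_eq_zero] at hi₀
    simpa [hi₀] using hs

lemma logMonomial_ne_zero (β : ℂ) (d : ℕ) {t : ℂ} (ht : t ≠ 0) : logMonomial β d t ≠ 0 :=
  mul_ne_zero (Complex.exp_ne_zero _) (pow_ne_zero _ ht)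

lemma norm_logMonomial_div (β γ : ℂ) (d e : ℕ) (x : ℝ) :
    ‖logMonomial β d x / logMonomial γ e x‖ =
      Real.exp ((β.re - γ.re) * x) * (|x| ^ d / |x| ^ e) := by
  simp only [logMonomial, norm_div, norm_mul, norm_pow, norm_exp, norm_real, Real.norm_eq_abs,
    re_mul_ofReal, sub_mul, Real.exp_sub, mul_div_mul_comm]

lemma tendsto_logMonomial_div {β γ : ℂ} {d e : ℕ} (h : γ.re < β.re ∨ γ.re = β.re ∧ d < e) :
    Tendsto (fun x : ℝ => logMonomial β d x / logMonomial γ e x) atBot (𝓝 0) := by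
  rw [tendsto_zero_iff_norm_tendsto_zero]
  simp only [norm_logMonomial_div]
  rcases h with hre | ⟨hre, hde⟩
  · have hexp := (isLittleO_pow_exp_pos_mul_atTop (k := d)
      (sub_pos.2 hre)).tendsto_div_nhds_zero.comp tendsto_neg_atBot_atTop
    refine squeeze_zero' (Eventually.of_forall fun x => by positivity) ?_ hexp
    filter_upwards [eventually_le_atBot (-1 : ℝ)] with x hx
    have habs : |x| = -x := abs_of_nonpos (by linarith)
    have hpow : |x| ^ d / |x| ^ e ≤ (-x) ^ d := by
      rw [habs]
      exact div_le_self (pow_nonneg (by linarith) _) (one_le_pow₀ (by linarith))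
    calc Real.exp ((β.re - γ.re) * x) * (|x| ^ d / |x| ^ e)
        ≤ Real.exp ((β.re - γ.re) * x) * (-x) ^ d := by gcongr
      _ = (-x) ^ d / Real.exp ((β.re - γ.re) * -x) := by
          rw [mul_neg, Real.exp_neg, div_inv_eq_mul, mul_comm]
  · have hpow : Tendsto (fun x : ℝ => (|x| ^ (e - d))⁻¹) atBot (𝓝 0) :=
      tendsto_inv_atTop_zero.comp
        ((tendsto_pow_atTop (Nat.sub_ne_zero_of_lt hde)).comp tendsto_abs_atBot_atTop)
    refine hpow.congr' ?_
    filter_upwards [eventually_lt_atBot (0 : ℝ)] with x hx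
    have hx₀ : |x| ≠ 0 := abs_ne_zero.2 hx.ne
    rw [hre, sub_self, zero_mul, Real.exp_zero, one_mul, pow_sub₀ _ hx₀ hde.le]
    field_simp

lemma tendsto_div_logMonomial_of_lt {g : ℝ → ℂ} {β γ C : ℂ} {d e : ℕ}
    (hg : Tendsto (fun x : ℝ => g x / logMonomial β d x) atBot (𝓝 C))
    (h : γ.re < β.re ∨ γ.re = β.re ∧ d < e) :
    Tendsto (fun x : ℝ => g x / logMonomial γ e x) atBot (𝓝 0) := by
  have hmul := hg.mul (tendsto_logMonomial_div h)
  rw [mul_zero] at hmul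
  refine hmul.congr' ?_
  filter_upwards [eventually_ne_atBot (0 : ℝ)] with x hx
  rw [div_mul_div_cancel₀ (logMonomial_ne_zero β d (ofReal_ne_zero.2 hx))]

lemma tendsto_mul_exp_sub_div_logMonomial {g : ℝ → ℂ} {β γ C : ℂ} {d : ℕ}
    (hg : Tendsto (fun x : ℝ => g x / logMonomial β d x) atBot (𝓝 C)) (h : β.re = γ.re) :
    Tendsto (fun x : ℝ => C * cexp ((β.im - γ.im : ℝ) * I * x) - g x / logMonomial γ d x)
      atBot (𝓝 0) := by
  have hβ : β = γ + (β.im - γ.im : ℝ) * I := Complex.ext (by simp [h]) (by simp)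
  rw [tendsto_zero_iff_norm_tendsto_zero]
  have hnorm := (tendsto_const_nhds (x := C) |>.sub hg).norm
  rw [sub_self, norm_zero] at hnorm
  refine hnorm.congr fun x => ?_
  have hdiv : g x / logMonomial γ d x =
      g x / logMonomial β d x * cexp ((β.im - γ.im : ℝ) * I * x) := by
    have hsplit : logMonomial β d x = cexp ((β.im - γ.im : ℝ) * I * x) * logMonomial γ d x := by
      rw [logMonomial, logMonomial, ← mul_assoc, ← Complex.exp_add, ← add_mul, add_comm, ← hβ]
    rw [hsplit, div_mul_eq_mul_div, mul_comm (g x), mul_div_mul_left _ _ (Complex.exp_ne_zero _)]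
  rw [hdiv, ← sub_mul, norm_mul, norm_exp]
  simp

lemma exists_dominant_exponent {s : Finset ι} (hs : s.Nonempty) (r : ι → ℝ) (d : ι → ℕ) :
    ∃ j₀ ∈ s, ∀ j ∈ s,
      (r j = r j₀ ∧ d j = d j₀) ∨ r j₀ < r j ∨ r j₀ = r j ∧ d j < d j₀ := by
  obtain ⟨j₀, hj₀, hmin⟩ := s.exists_min_image (fun j => toLex (r j, OrderDual.toDual (d j))) hs
  refine ⟨j₀, hj₀, fun j hj => ?_⟩
  rcases Prod.Lex.le_iff.1 (hmin j hj) with hlt | ⟨heq, hle⟩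
  · exact Or.inr (Or.inl hlt)
  · exact hle.eq_or_lt.imp (fun h => ⟨heq.symm, h.symm⟩) fun h => Or.inr ⟨heq, h⟩

lemma linearIndependent_of_tendsto_div_logMonomial {β C : ι → ℂ} {d : ι → ℕ} {g : ι → ℝ → ℂ}
    (hinj : Function.Injective fun j => (β j, d j)) (hC : ∀ j, C j ≠ 0)
    (hg : ∀ j, Tendsto (fun x : ℝ => g j x / logMonomial (β j) (d j) x) atBot (𝓝 (C j))) :
    LinearIndependent ℂ g := by
  classical
  rw [linearIndependent_iff']
  intro s a hsum
  by_contra! ⟨i, hi, hai⟩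
  set T := s.filter (a · ≠ 0)
  obtain ⟨j₀, hj₀, hdom⟩ := exists_dominant_exponent (s := T)
    ⟨i, Finset.mem_filter.2 ⟨hi, hai⟩⟩ (fun j => (β j).re) d
  set J := T.filter fun j => (β j).re = (β j₀).re ∧ d j = d j₀
  have hJT : T ∩ J = J := Finset.inter_eq_right.2 (Finset.filter_subset _ _)
  set ν : ι → ℝ := fun j => (β j).im - (β j₀).im
  have hν : InjOn ν J := by
    intro j hj k hk hjk
    obtain ⟨hj, hk⟩ := (Finset.mem_filter.1 hj).2, (Finset.mem_filter.1 hk).2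
    exact hinj (Prod.ext (Complex.ext (hj.1.trans hk.1.symm) (sub_left_injective hjk))
      (hj.2.trans hk.2.symm))
  have hterm : ∀ j ∈ T, Tendsto (fun x : ℝ =>
      (if j ∈ J then a j * C j * cexp (ν j * I * x) else 0) -
        a j * (g j x / logMonomial (β j₀) (d j₀) x)) atBot (𝓝 0) := by
    intro j hj
    split_ifs with hjJ
    · obtain ⟨hre, hd⟩ := (Finset.mem_filter.1 hjJ).2
      simpa only [hd, mul_zero, mul_sub, mul_assoc] using
        (tendsto_mul_exp_sub_div_logMonomial (hg j) hre).const_mul (a j)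
    · have hlt := (hdom j hj).resolve_left fun h => hjJ (Finset.mem_filter.2 ⟨hj, h⟩)
      simpa using (tendsto_div_logMonomial_of_lt (hg j) hlt).const_mul (-a j)
  have hzero (x : ℝ) : ∑ j ∈ T, a j * (g j x / logMonomial (β j₀) (d j₀) x) = 0 := by
    have hx : ∑ j ∈ s, a j * g j x = 0 := by
      simpa only [Finset.sum_apply, Pi.smul_apply, smul_eq_mul, Pi.zero_apply]
        using congrFun hsum x
    simp only [← mul_div_assoc, ← Finset.sum_div]
    rw [Finset.sum_filter_of_ne fun j _ hj => left_ne_zero_of_mul hj, hx, zero_div]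
  have hlim := tendsto_finsetSum T hterm
  simp only [Finset.sum_sub_distrib, hzero, sub_zero, Finset.sum_const_zero, Finset.sum_ite_mem,
    hJT] at hlim
  have hlead : a j₀ * C j₀ = 0 := eq_zero_of_tendsto_sum_mul_exp_mul_I
    (A := fun j => a j * C j) hν hlim j₀ (Finset.mem_filter.2 ⟨hj₀, rfl, rfl⟩)
  exact mul_ne_zero (Finset.mem_filter.1 hj₀).2 (hC j₀) hlead

lemma tendsto_comp_add_div_logMonomial {G : ℂ → ℂ} {β C : ℂ} {k : ℕ}
    (h : ∀ A : ℝ, Tendsto (fun t => G t / logMonomial β k t) (leftStrip A) (𝓝 C)) (c : ℂ) :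
    Tendsto (fun x : ℝ => G (x + c) / logMonomial β k x) atBot (𝓝 (C * cexp (β * c))) := by
  have hstrip : Tendsto (fun x : ℝ => (x : ℂ) + c) atBot (leftStrip |c.im|) := by
    refine tendsto_inf.2 ⟨tendsto_comap_iff.2 ?_, tendsto_principal.2 ?_⟩
    · simpa [Function.comp_def] using tendsto_atBot_add_const_right atBot c.re tendsto_id
    · simp
  have hne : ∀ᶠ x : ℝ in atBot, (x : ℂ) ≠ 0 ∧ (x : ℂ) + c ≠ 0 := by
    filter_upwards [eventually_lt_atBot (0 : ℝ), eventually_lt_atBot (-c.re)] with x hx hxc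
    refine ⟨ofReal_ne_zero.2 hx.ne, fun h₀ => ?_⟩
    have hre : x + c.re = 0 := by simpa using congrArg re h₀
    linarith
  have hratio : Tendsto (fun x : ℝ => (1 + c * (x : ℂ)⁻¹) ^ k) atBot (𝓝 1) := by
    have hinv : Tendsto (fun x : ℝ => (x : ℂ)⁻¹) atBot (𝓝 0) := by
      simpa [Function.comp_def] using (continuous_ofReal.tendsto 0).comp tendsto_inv_atBot_zero
    simpa using ((hinv.const_mul c).const_add 1).pow k
  have hlim := ((h |c.im|).comp hstrip).mul (hratio.const_mul (cexp (β * c)))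
  rw [mul_one] at hlim
  refine hlim.congr' ?_
  filter_upwards [hne] with x ⟨hx, hxc⟩
  have hadd : 1 + c * (x : ℂ)⁻¹ = (x + c) / x := by field_simp
  simp only [Function.comp, logMonomial, mul_add, Complex.exp_add, hadd, div_pow]
  field_simp [Complex.exp_ne_zero]

lemma exists_log_branch_exp_eq_add {U : Set ℂ} (hU : IsOpen U) {L : ℂ → ℂ}
    (hL : ∀ ζ ∈ U, HasDerivAt L ζ⁻¹ ζ) {t₀ : ℂ} (ht₀ : cexp t₀ ∈ U) :
    ∃ c, ∀ᶠ t in 𝓝 t₀, L (cexp t) = t + c := by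
  obtain ⟨r, hr, hball⟩ := Metric.mem_nhds_iff.1
    ((hU.preimage Complex.continuous_exp).mem_nhds ht₀)
  have hd : ∀ t ∈ ball t₀ r, HasDerivAt (fun t => L (cexp t) - t) 0 t := fun t ht => by
    refine (((hL _ (hball ht)).comp t (Complex.hasDerivAt_exp t)).sub
      (hasDerivAt_id t)).congr_deriv ?_
    rw [inv_mul_cancel₀ (Complex.exp_ne_zero t), sub_self]
  refine ⟨L (cexp t₀) - t₀, ?_⟩
  filter_upwards [ball_mem_nhds t₀ hr] with t ht
  have hconst := isOpen_ball.is_const_of_deriv_eq_zero (convex_ball t₀ r).isPreconnected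
    (fun t ht => (hd t ht).differentiableAt.differentiableWithinAt)
    (fun t ht => (hd t ht).deriv) ht (mem_ball_self hr)
  linear_combination hconst

/-- Every branch is a translate of `t` near a point of the logarithmic surface, so that a linear
relation on `U` continues to the whole surface, where the leading terms at the origin decide. -/
lemma linearIndependent_comp_log_branch {U : Set ℂ} (hU : IsOpen U) (hUn : U.Nonempty)
    (hU0 : (0 : ℂ) ∉ U) {L : ι → ℂ → ℂ} (hL : ∀ j, ∀ ζ ∈ U, HasDerivAt (L j) ζ⁻¹ ζ)
    {β C : ι → ℂ} {d : ι → ℕ} {F : ι → ℂ → ℂ} (hF : ∀ j, Differentiable ℂ (F j))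
    (hinj : Function.Injective fun j => (β j, d j)) (hC : ∀ j, C j ≠ 0)
    (hlim : ∀ j A, Tendsto (fun t => F j t / logMonomial (β j) (d j) t) (leftStrip A) (𝓝 (C j))) :
    LinearIndependent ℂ fun j (ζ : U) => F j (L j ζ) := by
  obtain ⟨ζ₀, hζ₀⟩ := hUn
  have ht₀ : cexp (log ζ₀) = ζ₀ := exp_log (ne_of_mem_of_not_mem hζ₀ hU0)
  choose c hc using fun j => exists_log_branch_exp_eq_add hU (hL j) (ht₀.symm ▸ hζ₀)
  have hind : LinearIndependent ℂ fun j (x : ℝ) => F j (x + c j) :=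
    linearIndependent_of_tendsto_div_logMonomial hinj
      (fun j => mul_ne_zero (hC j) (Complex.exp_ne_zero _))
      fun j => tendsto_comp_add_div_logMonomial (hlim j) (c j)
  rw [linearIndependent_iff'] at hind ⊢
  intro s a hsum
  have hU' : ∀ ζ ∈ U, ∑ j ∈ s, a j * F j (L j ζ) = 0 := fun ζ hζ => by
    simpa only [Finset.sum_apply, Pi.smul_apply, smul_eq_mul, Pi.zero_apply]
      using congrFun hsum ⟨ζ, hζ⟩
  have hdiff : Differentiable ℂ fun t => ∑ j ∈ s, a j * F j (t + c j) := by
    fun_prop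
  have hzero : (fun t => ∑ j ∈ s, a j * F j (t + c j)) = 0 := by
    refine AnalyticOnNhd.eq_of_eventuallyEq (z₀ := log ζ₀) (fun z _ => hdiff.analyticAt z)
      (fun z _ => analyticAt_const) ?_
    filter_upwards [(eventually_all_finset s).2 fun j _ => hc j,
      Complex.continuous_exp.continuousAt.preimage_mem_nhds (hU.mem_nhds (ht₀.symm ▸ hζ₀))]
      with t ht htU
    rw [Pi.zero_apply, ← hU' _ htU]
    exact Finset.sum_congr rfl fun j hj => by rw [ht j hj]
  refine hind s a (funext fun x => ?_)
  simpa only [Finset.sum_apply, Pi.smul_apply, smul_eq_mul, Pi.zero_apply] using congrFun hzero x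

end linearIndependent

section blocks

variable {q : ℕ} {b : Fin q → ℂ} {c : Composition q} {i j : Fin q}

lemma mem_upTo_iff : i ∈ upTo c j ↔ c.index i = c.index j ∧ i ≤ j := by
  simp only [upTo, Finset.mem_filter, Finset.mem_univ, true_and]

lemma self_mem_upTo (c : Composition q) (j : Fin q) : j ∈ upTo c j :=
  mem_upTo_iff.2 ⟨rfl, le_rfl⟩

lemma card_upTo (c : Composition q) (j : Fin q) : (upTo c j).card = pos c j := by
  have hmap : upTo c j =
      (Finset.Iic (c.invEmbedding j)).map (c.embedding (c.index j)).toEmbedding := by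
    ext i
    simp only [mem_upTo_iff, Finset.mem_map, Finset.mem_Iic, RelEmbedding.coe_toEmbedding]
    constructor
    · rintro ⟨hidx, hij⟩
      obtain ⟨k, rfl⟩ := c.mem_range_embedding_iff'.2 hidx.symm
      refine ⟨k, (c.embedding (c.index j)).le_iff_le.1 ?_, rfl⟩
      rwa [c.embedding_comp_inv]
    · rintro ⟨k, hk, rfl⟩
      refine ⟨c.index_embedding _ _, ?_⟩
      simpa only [c.embedding_comp_inv] using (c.embedding (c.index j)).le_iff_le.2 hk
  rw [hmap, Finset.card_map, Fin.card_Iic, pos]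

lemma upTo_eq_singleton (hj : pos c j = 1) : upTo c j = {j} := by
  obtain ⟨i, hi⟩ := Finset.card_eq_one.1 ((card_upTo c j).trans hj)
  have hji := self_mem_upTo c j
  rw [hi, Finset.mem_singleton] at hji
  rw [hi, hji]

lemma mult_eq_card (c : Composition q) (b : Fin q → ℂ) (j : Fin q) :
    mult c b j = ((upTo c j).filter (b · = b j)).card :=
  Nat.subtype_card _ (by simp)

lemma mult_pos (c : Composition q) (b : Fin q → ℂ) (j : Fin q) : 0 < mult c b j := by
  rw [mult_eq_card, Finset.card_pos]
  exact ⟨j, Finset.mem_filter.2 ⟨self_mem_upTo c j, rfl⟩⟩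

lemma mult_lt_mult (hidx : c.index i = c.index j) (hij : i < j) (hb : b i = b j) :
    mult c b i < mult c b j := by
  rw [mult_eq_card, mult_eq_card]
  refine Finset.card_lt_card (Finset.ssubset_iff_of_subset (fun s hs => ?_) |>.2 ⟨j, ?_, ?_⟩)
  · simp only [Finset.mem_filter, mem_upTo_iff] at hs ⊢
    exact ⟨⟨hs.1.1.trans hidx, hs.1.2.trans hij.le⟩, hs.2.trans hb⟩
  · simp [self_mem_upTo]
  · simp [mem_upTo_iff, hij]

lemma injective_prodMk_mult (hclass : ∀ i j, b i = b j → c.index i = c.index j) :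
    Function.Injective fun j => (b j, mult c b j - 1) := by
  intro i j hij
  obtain ⟨hb, hm⟩ := Prod.ext_iff.1 hij
  have hidx := hclass i j hb
  have hm' : mult c b i = mult c b j := Nat.sub_one_cancel (mult_pos c b i) (mult_pos c b j) hm
  exact le_antisymm (not_lt.1 fun h => (mult_lt_mult hidx.symm h hb.symm).ne' hm')
    (not_lt.1 fun h => (mult_lt_mult hidx h hb).ne hm')

variable (hclass : ∀ i j, c.index i = c.index j ↔ ∃ k : ℤ, b i - b j = k)
  (hre : ∀ i j, c.index i = c.index j → i ≤ j → (b j).re ≤ (b i).re)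
include hclass hre

lemma exists_nat_of_mem_upTo (hi : i ∈ upTo c j) : ∃ n : ℕ, b i = b j + n := by
  obtain ⟨hidx, hij⟩ := mem_upTo_iff.1 hi
  obtain ⟨k, hk⟩ := (hclass i j).1 hidx
  have hkre : (b i).re - (b j).re = k := by simpa using congrArg re hk
  have hk₀ : (0 : ℝ) ≤ k := hkre ▸ sub_nonneg.2 (hre i j hidx hij)
  obtain ⟨n, rfl⟩ := Int.eq_ofNat_of_zero_le (Int.cast_nonneg_iff.1 hk₀)
  exact ⟨n, by rwa [← sub_eq_iff_eq_add', ← Int.cast_natCast]⟩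

lemma ne_add_of_notMem_upTo (hi : i ∉ upTo c j) (n : ℕ) : b i ≠ b j + (n + 1) := by
  intro h
  have hidx : c.index i = c.index j := (hclass i j).2 ⟨n + 1, by rw [h]; push_cast; ring⟩
  have hji : j ≤ i := le_of_not_ge fun hij => hi (mem_upTo_iff.2 ⟨hidx, hij⟩)
  have hle := hre j i hidx.symm hji
  have hre_eq : (b i).re = (b j).re + (n + 1) := by simpa using congrArg re h
  linarith [n.cast_nonneg (α := ℝ)]

lemma meijerPoles_upTo (j : Fin q) :
    meijerPoles b (upTo c j) = range fun m : ℕ => b j + m := by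
  ext ω
  constructor
  · rintro ⟨i, hi, n, rfl⟩
    obtain ⟨m, hm⟩ := exists_nat_of_mem_upTo hclass hre hi
    exact ⟨m + n, by rw [hm]; push_cast; ring⟩
  · rintro ⟨m, rfl⟩
    exact ⟨j, self_mem_upTo c j, m, rfl⟩

lemma tendsto_meijerG_upTo (hq : 1 ≤ q) (j : Fin q) : ∃ C : ℂ, C ≠ 0 ∧ ∀ A : ℝ,
    Tendsto (fun t => meijerG b (upTo c j) t / logMonomial (b j) (mult c b j - 1) t)
      (leftStrip A) (𝓝 C) :=
  tendsto_meijerG hq (meijerPoles_upTo hclass hre j)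
    (fun _ => ne_add_of_notMem_upTo hclass hre)
    (by rw [← mult_eq_card, Nat.sub_add_cancel (mult_pos c b j)])

lemma linearIndependent_meijerG (hq : 1 ≤ q) {U : Set ℂ} (hU : IsOpen U) (hUn : U.Nonempty)
    (hU0 : (0 : ℂ) ∉ U) {L : Fin q → ℂ → ℂ} (hL : ∀ j, ∀ ζ ∈ U, HasDerivAt (L j) ζ⁻¹ ζ) :
    LinearIndependent ℂ fun j (ζ : U) => meijerG b (upTo c j) (L j ζ) := by
  choose C hC hlim using tendsto_meijerG_upTo hclass hre hq
  refine linearIndependent_comp_log_branch hU hUn hU0 hL (fun j => ?_)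
    (injective_prodMk_mult fun i j hb => (hclass i j).2 ⟨0, by simp [hb]⟩) hC hlim
  exact differentiable_meijerG hq (meijerPoles_upTo hclass hre j)

end blocks

end MeijerEuler

end

theorem theorem3p1 {q : ℕ} (hq : 1 ≤ q) (b : Fin q → ℂ)
    -- the blocks of `c` are the congruence classes mod `ℤ`, each ordered by decreasing real part
    (c : Composition q)
    (hclass : ∀ i j, c.index i = c.index j ↔ ∃ k : ℤ, b i - b j = k)
    (hre : ∀ i j, c.index i = c.index j → i ≤ j → (b j).re ≤ (b i).re)
    -- a domain in `ℂ \ {0}` with branches `L j` of `log ((-1) ^ ℓ * ζ)`, `ℓ` the position of `j`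
    (U : Set ℂ) (hUo : IsOpen U) (hUc : IsConnected U) (hU0 : (0 : ℂ) ∉ U)
    (L : Fin q → ℂ → ℂ) (hLc : ∀ j, ContinuousOn (L j) U)
    (hL : ∀ j, ∀ ζ ∈ U, Complex.exp (L j ζ) = (-1) ^ MeijerEuler.pos c j * ζ) :
    -- the sums of residues converge absolutely
    (∀ (j : Fin q) (t : ℂ),
      Summable fun ω : MeijerEuler.meijerPoles b (MeijerEuler.upTo c j) =>
        ‖MeijerEuler.residue
          (MeijerEuler.meijerIntegrand b (MeijerEuler.upTo c j) t) (ω : ℂ)‖) ∧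
    -- fundamental system
    MeijerEuler.IsFundamentalSystem b U
      (fun j ζ => MeijerEuler.meijerG b (MeijerEuler.upTo c j) (L j ζ)) ∧
    -- the first solution of each class
    (∀ j, MeijerEuler.pos c j = 1 → ∀ ζ ∈ U,
      MeijerEuler.meijerG b (MeijerEuler.upTo c j) (L j ζ) =
        Complex.exp (b j * L j ζ) / (∏ i, Complex.Gamma (1 + b j - b i)) *
          MeijerEuler.hypergeometricZeroF (fun i : {i // i ≠ j} => 1 + b j - b i) ζ) ∧
    -- leading asymptotics, with logarithms, at the origin
    (∀ j, ∃ C : ℂ, C ≠ 0 ∧ ∀ A : ℝ,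
      Tendsto
        (fun t : ℂ => MeijerEuler.meijerG b (MeijerEuler.upTo c j) t /
          (Complex.exp (b j * t) * t ^ (MeijerEuler.mult c b j - 1)))
        (comap Complex.re atBot ⊓ 𝓟 {t : ℂ | |t.im| ≤ A}) (𝓝 C)) := by
  open MeijerEuler in
  have hpoles := meijerPoles_upTo hclass hre
  have hLd : ∀ j, ∀ ζ ∈ U, HasDerivAt (L j) ζ⁻¹ ζ := fun j _ =>
    hasDerivAt_log_branch hUo (hLc j) (by simp) (hL j)
  refine ⟨fun j => summable_norm_residue hq (hpoles j), ?_, fun j hj ζ hζ => ?_,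
    tendsto_meijerG_upTo hclass hre hq⟩
  · refine isFundamentalSystem_of_linearIndependent hq hUo hUc hU0 (fun j => ?_)
      (linearIndependent_meijerG hclass hre hq hUo hUc.nonempty hU0 hLd)
    exact isSolution_meijerG hq (hpoles j) hUo hU0 (hLc j) (card_upTo c j ▸ hL j)
  · have hsing := upTo_eq_singleton hj
    have hne : ∀ i, ∀ n : ℕ, b i ≠ b j + (n + 1) := fun i n h => by
      by_cases hij : i = j
      · exact n.cast_add_one_ne_zero (left_eq_add.1 (hij ▸ h))
      · exact ne_add_of_notMem_upTo hclass hre (by simpa [hsing] using hij) n h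
    rw [hsing]
    exact meijerG_singleton hne (by rw [hL j ζ hζ, hj, pow_one, neg_one_mul])
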